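/- Fix integers $1\le p<n$. For an integer $a$ let $a \bmod n$ denote its representative in $\{1,\dots,n\}$. Let $R=\mathbb C[z_{i,j}^{(k)} : 1\le i\le p,\ 1\le j\le n,\ k\ge 0]$. Let $Z(t)$ be the $p\times n$ matrix with entries $z_{i,j}(t)=\sum_{k\ge 0} z_{i,j}^{(k)}t^k$. For a $p$-tuple $I=(\alpha_1,\dots,\alpha_p)$ of elements of $\{1,\dots,n\}$ let $D_I(t)$ be the determinant of the $p\times p$ matrix whose $j$-th column is the $\alpha_j$-th column of $Z(t)$, and let $D_I^{(k)}\in R$ be the coefficient of $t^k$ in $D_I(t)$. The semi-infinite Plücker algebra $\tilde{\mathcal P}\subset R$ is the $\mathbb C$-subalgebra generated by all $D_I^{(k)}$. Order the variables $z_{i,j}^{(k)}$ first by $k$ increasingly, then by $i$ increasingly, and for fixed $k,i$ cyclically in $j$ starting from $j=(kp+i) \bmod n$. Let $<_{\mathrm{pbw}}$ be the degree reverse lexicographic order for this ordering: a monomial with exponent vector $a$ is smaller than one with exponent vector $b$ if its total degree is smaller, or if the total degrees are equal and $a_v>b_v$ at the last variable $v$ at which $a$ and $b$ differ. For $f\in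 R$, $f\ne 0$, let $\mathrm{in}(f)$ be the $<_{\mathrm{pbw}}$-maximal term of $f$ (including its coefficient), and for a subalgebra $A\subset R$ let $\mathrm{in}(A)$ be the subalgebra spanned over $\mathbb C$ by the initial terms of all nonzero elements of $A$. A set $S\subset A$ is a sagbi basis of $A$ if $S$ generates $A$ and $\{\mathrm{in}(s) : s\in S\}$ generates $\mathrm{in}(A)$. A tuple $(\beta_1,\dots,\beta_p)$ of elements of $\{1,\dots,n\}$ is a PBW tuple if its entries are pairwise distinct, $\beta_j=j$ whenever $\beta_j\le p$, and $j<l$ whenever $\beta_j>\beta_l>p$. Let $\tilde{\mathcal I}_{\mathrm{pbw}}$ be the set of pairs $I^{(k)}$, consisting of a $p$-tuple $I=(\alpha_1,\dots,\alpha_p)$ of elements of $\{1,\dots,n\}$ and an integer $k\ge 0$, for which $((\alpha_1-k)\bmod n,\dots,(\alpha_p-k)\bmod n)$ is a PBW tuple. Theorem. The polynomials $D_I^{(k)}$ with $I^{(k)}\in\tilde{\mathcal I}_{\mathrm{pbw}}$ form a sagbi basis of $\tilde{\mathcal P}$ with respect to $<_{\mathrm{pbw}}$. -/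

import Mathlib

open MvPolynomial

/-! ### Monomial orders, initial subalgebras, sagbi bases -/

/-- A monomial order on the polynomials in the variables `σ`: a strict total order on monomials
(written as exponent vectors) that is preserved under multiplication by each variable.  It is not
required to be a well-order. -/
structure MonOrder (σ : Type*) where
  lt : (σ →₀ ℕ) → (σ →₀ ℕ) → Prop
  irrefl : ∀ a, ¬ lt a a
  trans : ∀ a b c, lt a b → lt b c → lt a c
  total : ∀ a b, lt a b ∨ a = b ∨ lt b a
  mul_var : ∀ (i : σ) (a b), lt a b → lt (a + Finsupp.single i 1) (b + Finsupp.single i 1)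

namespace MonOrder

variable {σ : Type*} (m : MonOrder σ)

/-- `d` is the exponent vector of the greatest monomial occurring in `f`. -/
def IsInitialExp (f : MvPolynomial σ ℂ) (d : σ →₀ ℕ) : Prop :=
  d ∈ f.support ∧ ∀ e ∈ f.support, e ≠ d → m.lt e d

open Classical in
/-- The initial term of `f` (with its coefficient); it is `0` for `f = 0`. -/
noncomputable def initialTerm (f : MvPolynomial σ ℂ) : MvPolynomial σ ℂ :=
  if h : ∃ d, m.IsInitialExp f d then monomial h.choose (f.coeff h.choose) else 0

theorem add_lt (a b c : σ →₀ ℕ) (h : m.lt a b) : m.lt (a + c) (b + c) := by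
  classical
  induction c using Finsupp.induction_linear generalizing a b with
  | zero => simpa using h
  | add f g hf hg => simpa only [← add_assoc] using hg _ _ (hf _ _ h)
  | single i n =>
    induction n with
    | zero => simpa using h
    | succ n ih =>
      simpa only [Finsupp.single_add, ← add_assoc] using m.mul_var i _ _ ih

theorem exists_isInitialExp {f : MvPolynomial σ ℂ} (hf : f ≠ 0) :
    ∃ d, m.IsInitialExp f d := by
  classical
  have key : ∀ s : Finset (σ →₀ ℕ), s.Nonempty → ∃ d ∈ s, ∀ e ∈ s, e ≠ d → m.lt e d := by
    intro s hs
    induction hs using Finset.Nonempty.cons_induction with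
    | singleton a => exact ⟨a, by simp, by simp⟩
    | cons a s ha hs ih =>
      obtain ⟨d, hd, hmax⟩ := ih
      rcases m.total a d with h | h | h
      · refine ⟨d, by simp [hd], fun e he hne => ?_⟩
        rcases Finset.mem_cons.1 he with rfl | he
        · exact h
        · exact hmax e he hne
      · exact absurd (h ▸ hd) ha
      · refine ⟨a, by simp, fun e he hne => ?_⟩
        rcases Finset.mem_cons.1 he with rfl | he
        · exact absurd rfl hne
        · by_cases hed : e = d
          · exact hed ▸ h
          · exact m.trans _ _ _ (hmax e he hed) h
  exact key f.support (MvPolynomial.support_nonempty.2 hf)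

variable {m}

theorem IsInitialExp.unique {f : MvPolynomial σ ℂ} {d e : σ →₀ ℕ}
    (hd : m.IsInitialExp f d) (he : m.IsInitialExp f e) : d = e := by
  by_contra h
  exact m.irrefl _ (m.trans _ _ _ (he.2 d hd.1 h) (hd.2 e he.1 (Ne.symm h)))

theorem IsInitialExp.initialTerm_eq {f : MvPolynomial σ ℂ} {d : σ →₀ ℕ}
    (hd : m.IsInitialExp f d) : m.initialTerm f = monomial d (f.coeff d) := by
  have h : ∃ d, m.IsInitialExp f d := ⟨d, hd⟩
  rw [initialTerm, dif_pos h, h.choose_spec.unique hd]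

variable (m)

theorem initialTerm_zero : m.initialTerm (0 : MvPolynomial σ ℂ) = 0 := by
  rw [initialTerm, dif_neg]
  rintro ⟨d, hd, -⟩
  simp at hd

theorem initialTerm_mul (f g : MvPolynomial σ ℂ) :
    m.initialTerm f * m.initialTerm g = m.initialTerm (f * g) := by
  classical
  by_cases hf : f = 0
  · simp [hf, initialTerm_zero]
  by_cases hg : g = 0
  · simp [hg, initialTerm_zero]
  obtain ⟨d, hd⟩ := m.exists_isInitialExp hf
  obtain ⟨e, he⟩ := m.exists_isInitialExp hg
  have hlt : ∀ a ∈ f.support, ∀ b ∈ g.support, (a, b) ≠ (d, e) → m.lt (a + b) (d + e) := by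
    intro a ha b hb hne
    by_cases had : a = d
    · subst had
      have hbe : b ≠ e := fun h => hne (by rw [h])
      have := m.add_lt _ _ a (he.2 b hb hbe)
      rwa [add_comm b, add_comm e] at this
    · have h1 := m.add_lt _ _ b (hd.2 a ha had)
      by_cases hbe : b = e
      · rwa [hbe] at h1 ⊢
      · have h2 := m.add_lt _ _ d (he.2 b hb hbe)
        rw [add_comm b, add_comm e] at h2
        exact m.trans _ _ _ h1 h2
  have hcoeff : (f * g).coeff (d + e) = f.coeff d * g.coeff e := by
    rw [coeff_mul]
    refine Finset.sum_eq_single (d, e) ?_ ?_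
    · rintro ⟨a, b⟩ hab hne
      by_contra h0
      have ha : a ∈ f.support := mem_support_iff.2 (left_ne_zero_of_mul h0)
      have hb : b ∈ g.support := mem_support_iff.2 (right_ne_zero_of_mul h0)
      have := hlt a ha b hb hne
      rw [Finset.HasAntidiagonal.mem_antidiagonal.1 hab] at this
      exact m.irrefl _ this
    · intro h
      simp at h
  have hfg : m.IsInitialExp (f * g) (d + e) := by
    refine ⟨?_, fun c hc hne => ?_⟩
    · rw [mem_support_iff, hcoeff]
      exact mul_ne_zero (mem_support_iff.1 hd.1) (mem_support_iff.1 he.1)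
    · obtain ⟨a, ha, b, hb, rfl⟩ := Finset.mem_add.1 (support_mul f g hc)
      refine hlt a ha b hb fun h => hne ?_
      rw [(Prod.mk.inj h).1, (Prod.mk.inj h).2]
  rw [hd.initialTerm_eq, he.initialTerm_eq, hfg.initialTerm_eq, monomial_mul, hcoeff]

theorem initialTerm_one : m.initialTerm (1 : MvPolynomial σ ℂ) = 1 := by
  classical
  have h : m.IsInitialExp (1 : MvPolynomial σ ℂ) 0 := by
    refine ⟨by simp, fun e he hne => ?_⟩
    rw [mem_support_iff, coeff_one] at he
    simp only [ne_eq, ite_eq_right_iff, one_ne_zero, imp_false, not_not] at he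
    exact absurd he.symm hne
  rw [h.initialTerm_eq]
  simp

/-- The initial subalgebra of `A`: the linear span of the initial terms of all elements of `A`. -/
noncomputable def initialSubalgebra (A : Subalgebra ℂ (MvPolynomial σ ℂ)) :
    Subalgebra ℂ (MvPolynomial σ ℂ) :=
  (Submodule.span ℂ (m.initialTerm '' (A : Set (MvPolynomial σ ℂ)))).toSubalgebra
    (Submodule.subset_span ⟨1, A.one_mem, m.initialTerm_one⟩)
    (by
      intro x y hx hy
      have h := Submodule.mul_mem_mul hx hy
      rw [Submodule.span_mul_span] at h
      refine Submodule.span_mono ?_ h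
      rintro _ ⟨_, ⟨f, hf, rfl⟩, _, ⟨g, hg, rfl⟩, rfl⟩
      exact ⟨f * g, A.mul_mem hf hg, (m.initialTerm_mul f g).symm⟩)

/-- `S` is a sagbi basis of `A`: it generates `A` as an algebra, and the initial terms of its
elements generate the initial subalgebra of `A`. -/
def IsSagbiBasis (S : Set (MvPolynomial σ ℂ)) (A : Subalgebra ℂ (MvPolynomial σ ℂ)) : Prop :=
  Algebra.adjoin ℂ S = A ∧ Algebra.adjoin ℂ (m.initialTerm '' S) = m.initialSubalgebra A

/-- The degree reverse lexicographic order for an ordered set of variables: `a < b` if the total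
degree of `a` is smaller, or the degrees agree and `a i > b i` at the last variable `i` at which
`a` and `b` differ. -/
noncomputable def degRevLex (σ : Type*) [LinearOrder σ] : MonOrder σ where
  lt a b := a.degree < b.degree ∨
    (a.degree = b.degree ∧ ∃ i, b i < a i ∧ ∀ j, i < j → a j = b j)
  irrefl a := by
    rintro (h | ⟨-, i, hi, -⟩)
    · exact lt_irrefl _ h
    · exact lt_irrefl _ hi
  trans a b c := by
    rintro (h | ⟨h, i, hi, hi'⟩) (k | ⟨k, j, hj, hj'⟩)
    · exact Or.inl (h.trans k)
    · exact Or.inl (k ▸ h)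
    · exact Or.inl (h ▸ k)
    · refine Or.inr ⟨h.trans k, ?_⟩
      rcases lt_trichotomy i j with hij | hij | hij
      · exact ⟨j, (hi' j hij).symm ▸ hj, fun l hl => (hi' l (hij.trans hl)).trans (hj' l hl)⟩
      · subst hij
        exact ⟨i, hj.trans hi, fun l hl => (hi' l hl).trans (hj' l hl)⟩
      · exact ⟨i, hj' i hij ▸ hi, fun l hl => (hi' l hl).trans (hj' l (hij.trans hl))⟩
  total a b := by
    rcases lt_trichotomy a.degree b.degree with h | h | h
    · exact Or.inl (Or.inl h)
    · by_cases hab : a = b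
      · exact Or.inr (Or.inl hab)
      have hne : (a.neLocus b).Nonempty := Finsupp.nonempty_neLocus_iff.2 hab
      have h1 : a ((a.neLocus b).max' hne) ≠ b ((a.neLocus b).max' hne) :=
        Finsupp.mem_neLocus.1 (Finset.max'_mem _ hne)
      have h2 : ∀ j, (a.neLocus b).max' hne < j → a j = b j := by
        intro j hj
        by_contra hc
        exact absurd (Finset.le_max' _ j (Finsupp.mem_neLocus.2 hc)) (not_le.2 hj)
      rcases lt_or_gt_of_ne h1 with h3 | h3
      · exact Or.inr (Or.inr (Or.inr ⟨h.symm, _, h3, fun j hj => (h2 j hj).symm⟩))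
      · exact Or.inl (Or.inr ⟨h, _, h3, h2⟩)
    · exact Or.inr (Or.inr (Or.inl h))
  mul_var v a b := by
    rintro (h | ⟨h, i, hi, hi'⟩)
    · exact Or.inl (by simpa using h)
    · refine Or.inr ⟨by simpa using h, i, by simpa using hi, fun j hj => ?_⟩
      simp [hi' j hj]

end MonOrder

/-! ### The semi-infinite Plücker algebra

Rows and columns are numbered from `0`: the row `i : Fin p` stands for row `i + 1` and the column
`j : Fin n` for column `j + 1`, and residues modulo `n` are taken in `{0, …, n - 1}` instead of
`{1, …, n}`. -/

/-- The representative in `{0, …, n - 1}` of `a` modulo `n` (for `n ≥ 1`). -/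
def residue (n : ℕ) (a : ℤ) : ℕ := (a % (n : ℤ)).toNat

/-- The index of the variable `z_{i,j}^{(k)}`. -/
@[ext]
structure ZVar (p n : ℕ) where
  row : Fin p
  col : Fin n
  level : ℕ

namespace ZVar

variable {p n : ℕ}

/-- The sorting key of `z_{i,j}^{(k)}`: first `k`, then `i`, then the cyclic distance from the
starting column `k p + i mod n` to `j`. -/
def key (v : ZVar p n) : ℕ ×ₗ (ℕ ×ₗ ℕ) :=
  toLex (v.level, toLex ((v.row : ℕ),
    residue n ((v.col : ℤ) - ((v.level : ℤ) * (p : ℤ) + (v.row : ℤ)))))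

theorem key_injective : Function.Injective (key : ZVar p n → ℕ ×ₗ (ℕ ×ₗ ℕ)) := by
  rintro ⟨i, j, k⟩ ⟨i', j', k'⟩ h
  have h1 := congrArg ofLex h
  simp only [key, ofLex_toLex, Prod.mk.injEq] at h1
  obtain ⟨rfl, h2⟩ := h1
  have h3 := congrArg ofLex h2
  simp only [ofLex_toLex, Prod.mk.injEq] at h3
  obtain ⟨h4, h5⟩ := h3
  obtain rfl := Fin.ext h4
  have hj := j.isLt
  have hj' := j'.isLt
  have hn : (n : ℤ) ≠ 0 := by omega
  have h6 : ((j : ℤ) - ((k : ℤ) * p + (i : ℤ))) % (n : ℤ)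
      = ((j' : ℤ) - ((k : ℤ) * p + (i : ℤ))) % (n : ℤ) := by
    have a1 := Int.emod_nonneg ((j : ℤ) - ((k : ℤ) * p + (i : ℤ))) hn
    have a2 := Int.emod_nonneg ((j' : ℤ) - ((k : ℤ) * p + (i : ℤ))) hn
    unfold residue at h5
    omega
  have h8 : (j : ℤ) % (n : ℤ) = (j' : ℤ) % (n : ℤ) :=
    Int.ModEq.add_right_cancel' (-((k : ℤ) * p + (i : ℤ)))
      (by simpa only [sub_eq_add_neg, Int.ModEq] using h6)
  rw [Int.emod_eq_of_lt (by omega) (by omega), Int.emod_eq_of_lt (by omega) (by omega)] at h8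
  obtain rfl := Fin.ext (Int.ofNat.inj h8)
  rfl

/-- The ordering of the variables that defines the monomial order `<_pbw`. -/
noncomputable instance : LinearOrder (ZVar p n) := LinearOrder.lift' key key_injective

end ZVar

/-- The monomial order `<_pbw`. -/
noncomputable def pbwOrder (p n : ℕ) : MonOrder (ZVar p n) := MonOrder.degRevLex (ZVar p n)

/-- The matrix `Z(t)` with entries `z_{i,j}(t) = ∑_k z_{i,j}^{(k)} t^k`. -/
noncomputable def seriesMatrix (p n : ℕ) :
    Matrix (Fin p) (Fin n) (PowerSeries (MvPolynomial (ZVar p n) ℂ)) :=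
  fun i j => PowerSeries.mk fun k => X ⟨i, j, k⟩

/-- `D_I^{(k)}`: the coefficient of `t^k` in the determinant of the matrix formed by the columns
`I 0, …, I (p - 1)` of `Z(t)`, in this order. -/
noncomputable def coeffMinor {p n : ℕ} (I : Fin p → Fin n) (k : ℕ) : MvPolynomial (ZVar p n) ℂ :=
  PowerSeries.coeff k ((seriesMatrix p n).submatrix id I).det

/-- The semi-infinite Plücker algebra, generated by all `D_I^{(k)}`. -/
noncomputable def semiInfinitePlucker (p n : ℕ) : Subalgebra ℂ (MvPolynomial (ZVar p n) ℂ) :=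
  Algebra.adjoin ℂ {f | ∃ (I : Fin p → Fin n) (k : ℕ), f = coeffMinor I k}

/-- PBW tuples (entries numbered from `0`): the entries are distinct, each entry that is less than
`p` stands in the position equal to its value, and the other entries are decreasing. -/
def IsPBWTuple {p : ℕ} (β : Fin p → ℕ) : Prop :=
  Function.Injective β ∧ (∀ j, β j < p → β j = (j : ℕ)) ∧
    ∀ j l, β l < β j → p ≤ β l → j < l

/-- The set of pairs `(I, k)` such that `(I 0 - k mod n, …, I (p - 1) - k mod n)` is a PBW tuple. -/
def pbwIndexSet (p n : ℕ) : Set ((Fin p → Fin n) × ℕ) :=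
  {Ik | IsPBWTuple fun j => residue n ((Ik.1 j : ℤ) - (Ik.2 : ℤ))}

/-! Rearranging columns shows that the minors with PBW indices generate the algebra. Their initial
monomials are found in `isInitialExp_coeffMinor`: the `t`-th column is paired with the row and level
for which `p * level + row = k + t`, so the cyclic order of columns for this factor starts at `k +
t`. It remains to see that the initial monomial of every element of the algebra is a product of
these (`mem_pbwMonoid_of_isInitialExp`). This is a dimension count in each multigraded piece, by
comparison with a second family, the diagonal standard monomials.

Upper bound for the dimension. Adding `s t^e` times one row of `Z(t)` to another changes no minor.
Order the variables by position `level * n + column`. For the reverse lexicographic order, shear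
invariance forces lattice word inequalities on leading exponents (`IsShearInvariant.sum_Ico_le`),
and these say that the leading monomial is a product of strings `x_0 < ⋯ < x_{p-1} < x_0 + n`. Hence
every nonzero homogeneous element contains a diagonal standard monomial
(`exists_isDiagStandard_mem_support`), and no straightening relations are needed. To get the
inequalities, put `y_l = c_l x_l`. A shear then translates all `c_l` by `s`, and a translation
invariant polynomial is taken apart one variable at a time with control of the degree in `s`
(`exists_peel`).

Lower bound. Each string is encoded as the initial monomial of a PBW minor
(`exists_encode_eq_pbwExp`), and the resulting map on diagonal standard monomials preserves the
grading and is injective (`pbwImage_injOn`). So a graded piece has at least as many PBW products as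
diagonal standard monomials. One further initial monomial would yield a nonzero element of the
algebra without any diagonal standard monomial. -/

/-! ### Translation of polynomials -/

section Translation

variable {ι K : Type*} [Field K]

/-- The substitution `y_l ↦ y_l + s` with values in the polynomials in `s`. -/
noncomputable def translateVars (ι K : Type*) [Field K] :
    MvPolynomial ι K →ₐ[K] Polynomial (MvPolynomial ι K) :=
  aeval fun l => Polynomial.C (X l) + Polynomial.X

open Classical in
/-- The substitution `y_j ↦ 0`. -/
noncomputable def killVar (j : ι) : MvPolynomial ι K →ₐ[K] MvPolynomial ι K :=
  aeval fun l => if l = j then 0 else X l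

open Classical in
/-- The substitution `y_j ↦ -s`. -/
noncomputable def negParam (j : ι) :
    Polynomial (MvPolynomial ι K) →+* Polynomial (MvPolynomial ι K) :=
  Polynomial.eval₂RingHom (aeval (R := K) fun l =>
    if l = j then -Polynomial.X else Polynomial.C (X l) :
      MvPolynomial ι K →ₐ[K] Polynomial (MvPolynomial ι K)).toRingHom Polynomial.X

/-- After translation `y_j` has become `y_j + s`, which vanishes exactly for `y_j = -s`. -/
theorem translateVars_killVar (j : ι) (q : MvPolynomial ι K) :
    translateVars ι K (killVar j q) = negParam j (translateVars ι K q) := by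
  classical
  have : ((translateVars ι K).comp (killVar j)).toRingHom
      = (negParam j).comp (translateVars ι K).toRingHom := by
    refine MvPolynomial.ringHom_ext (fun r => ?_) fun l => ?_
    · simp [translateVars, killVar, negParam]
    · by_cases h : l = j <;> simp [translateVars, killVar, negParam, h]
  exact DFunLike.congr_fun this q

theorem translateVars_ne_zero {q : MvPolynomial ι K} (hq : q ≠ 0) : translateVars ι K q ≠ 0 := by
  intro h
  apply hq
  have : ((Polynomial.aeval (R := MvPolynomial ι K) (0 : MvPolynomial ι K)).restrictScalars K).comp
      (translateVars ι K) = AlgHom.id K _ := by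
    ext l : 1
    simp [translateVars]
  simpa [h] using (DFunLike.congr_fun this q).symm

theorem coeff_killVar (j : ι) (q : MvPolynomial ι K) (c : ι →₀ ℕ) :
    (killVar j q).coeff c = if c j = 0 then q.coeff c else 0 := by
  classical
  induction q using MvPolynomial.induction_on' with
  | add f g hf hg => rw [map_add, coeff_add, coeff_add, hf, hg]; split_ifs <;> simp
  | monomial u a =>
    by_cases hu : u j = 0
    · have : killVar j (monomial u a) = monomial u a := by
        rw [killVar, aeval_monomial, monomial_eq]
        congr 1
        refine Finsupp.prod_congr fun l hl => ?_
        have : l ≠ j := fun h => (Finsupp.mem_support_iff.1 hl) (h ▸ hu)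
        simp [this]
      rw [this, coeff_monomial]
      split_ifs with h1 h2 h2 <;> simp_all
    · have : killVar j (monomial u a) = 0 := by
        rw [killVar, aeval_monomial, Finsupp.prod,
          Finset.prod_eq_zero (Finsupp.mem_support_iff.2 hu), mul_zero]
        simp [hu]
      rw [this, coeff_monomial, coeff_zero]
      split_ifs with h1 h2 <;> simp_all

theorem degreeOf_coeff_mul_le (j : ι) {F G : Polynomial (MvPolynomial ι K)} {D E : ℕ}
    (hF : ∀ i, (F.coeff i).degreeOf j ≤ D) (hG : ∀ i, (G.coeff i).degreeOf j ≤ E) (i : ℕ) :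
    ((F * G).coeff i).degreeOf j ≤ D + E := by
  classical
  rw [Polynomial.coeff_mul]
  refine (degreeOf_sum_le _ _ _).trans (Finset.sup_le fun x _ => ?_)
  exact (degreeOf_mul_le _ _ _).trans (add_le_add (hF _) (hG _))

theorem degreeOf_coeff_translateVarsVars_monomial (j : ι) (u : ι →₀ ℕ) (a : K) (i : ℕ) :
    ((translateVars ι K (monomial u a)).coeff i).degreeOf j ≤ u j := by
  classical
  induction u using Finsupp.induction_linear generalizing a i with
  | zero =>
    have : translateVars ι K (monomial 0 a) = Polynomial.C (C a) := by
      rw [← C_apply, ← algebraMap_eq, AlgHom.commutes]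
      rfl
    rw [this, Polynomial.coeff_C]
    split_ifs <;> simp
  | add f g hf hg =>
    have : (monomial (f + g) a : MvPolynomial ι K) = monomial f a * monomial g 1 := by
      rw [monomial_mul, mul_one]
    rw [this, map_mul]
    exact degreeOf_coeff_mul_le j (hf a) (hg 1) i
  | single l e =>
    have hone : ∀ l i, ((Polynomial.C (X l) + Polynomial.X :
        Polynomial (MvPolynomial ι K)).coeff i).degreeOf j ≤ if l = j then 1 else 0 := by
      intro l i
      rw [Polynomial.coeff_add, Polynomial.coeff_C, Polynomial.coeff_X]
      refine (degreeOf_add_le _ _ _).trans (max_le ?_ ?_)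
      · split_ifs with h1 h2 h2
        · simp [degreeOf_X_self, h2]
        · rw [degreeOf_X_of_ne (Ne.symm h2)]
        · simp
        · simp
      · split_ifs <;> simp
    induction e generalizing i a with
    | zero =>
      have : translateVars ι K (monomial (Finsupp.single l 0) a) = Polynomial.C (C a) := by
        rw [Finsupp.single_zero, ← C_apply, ← algebraMap_eq, AlgHom.commutes]
        rfl
      rw [this, Polynomial.coeff_C]
      split_ifs <;> simp
    | succ e ih =>
      have : (monomial (Finsupp.single l (e + 1)) a : MvPolynomial ι K)
          = monomial (Finsupp.single l e) a * X l := by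
        rw [X, monomial_mul, mul_one, Finsupp.single_add]
      rw [this, map_mul]
      refine (degreeOf_coeff_mul_le j (fun i => ih a i) (E := if l = j then 1 else 0)
        (fun i => by simpa [translateVars] using hone l i) i).trans ?_
      by_cases h : l = j <;> simp [h]

theorem degreeOf_coeff_translateVars (j : ι) (q : MvPolynomial ι K) {D : ℕ}
    (h : ∀ c ∈ q.support, c j ≤ D) (i : ℕ) :
    ((translateVars ι K q).coeff i).degreeOf j ≤ D := by
  classical
  rw [q.as_sum, map_sum, Polynomial.finsetSum_coeff]
  exact (degreeOf_sum_le _ _ _).trans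
    (Finset.sup_le fun c hc => (degreeOf_coeff_translateVarsVars_monomial j c _ i).trans (h c hc))

theorem natDegree_negParam_C_le (j : ι) (g : MvPolynomial ι K) :
    (negParam j (Polynomial.C g)).natDegree ≤ g.degreeOf j := by
  classical
  rw [negParam, Polynomial.coe_eval₂RingHom, Polynomial.eval₂_C, AlgHom.toRingHom_eq_coe,
    RingHom.coe_coe, aeval_def,
    eval₂_eq]
  refine Polynomial.natDegree_sum_le_of_forall_le _ _ fun d hd => ?_
  refine Polynomial.natDegree_mul_le.trans ?_
  have h1 : (algebraMap K (Polynomial (MvPolynomial ι K)) (coeff d g)).natDegree = 0 :=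
    Polynomial.natDegree_C (C (coeff d g))
  rw [h1, zero_add]
  refine (Polynomial.natDegree_prod_le _ _).trans ?_
  calc ∑ i ∈ d.support, ((if i = j then -Polynomial.X else Polynomial.C (X i) :
          Polynomial (MvPolynomial ι K)) ^ d i).natDegree
      ≤ ∑ i ∈ d.support, if i = j then d j else 0 := by
        refine Finset.sum_le_sum fun i _ => Polynomial.natDegree_pow_le.trans ?_
        by_cases h : i = j <;> simp [h]
    _ ≤ d j := by
        rw [Finset.sum_ite_eq' d.support j]
        split_ifs <;> simp
    _ ≤ g.degreeOf j := monomial_le_degreeOf j hd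

/-- Each occurrence of `y_j` in a coefficient becomes `-s` and adds one to the degree in `s`. -/
theorem natDegree_negParam_le (j : ι) (F : Polynomial (MvPolynomial ι K)) {D : ℕ}
    (hF : ∀ i, (F.coeff i).degreeOf j ≤ D) :
    (negParam j F).natDegree ≤ F.natDegree + D := by
  classical
  conv_lhs => rw [F.as_sum_range_C_mul_X_pow, map_sum]
  refine Polynomial.natDegree_sum_le_of_forall_le _ _ fun i hi => ?_
  have hX : negParam j (Polynomial.X : Polynomial (MvPolynomial ι K)) = Polynomial.X := by
    simp [negParam]
  rw [map_mul, map_pow, hX]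
  refine Polynomial.natDegree_mul_le.trans ?_
  rw [Polynomial.natDegree_X_pow, add_comm]
  exact add_le_add (Nat.lt_succ_iff.1 (Finset.mem_range.1 hi))
    ((natDegree_negParam_C_le j _).trans (hF i))

/-- Dividing by the largest power of `y_j` and setting `y_j = 0` in the quotient changes the degree
in the translation parameter in a controlled way. -/
theorem exists_peel (j : ι) {q : MvPolynomial ι K} {ν b D : ℕ}
    (hν : (translateVars ι K q).natDegree ≤ ν) (hb : ∀ c ∈ q.support, b ≤ c j)
    (hD : ∀ c ∈ q.support, c j ≤ D) (hq : q ≠ 0) :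
    b ≤ ν ∧ ∃ g : MvPolynomial ι K, (translateVars ι K g).natDegree + 2 * b ≤ ν + D ∧
      ∀ c, g.coeff c = if c j = 0 then q.coeff (c + Finsupp.single j b) else 0 := by
  classical
  set u : MvPolynomial ι K := q.divMonomial (Finsupp.single j b) with hu
  have hu_coeff : ∀ c, u.coeff c = q.coeff (c + Finsupp.single j b) := fun c => by
    rw [hu, coeff_divMonomial, add_comm]
  have hqu : q = X j ^ b * u := by
    ext c
    rw [X_pow_eq_monomial, coeff_monomial_mul']
    split_ifs with h
    · rw [hu_coeff, one_mul, tsub_add_cancel_of_le h]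
    · by_contra h0
      exact h (Finsupp.single_le_iff.2 (hb c (mem_support_iff.2 h0)))
  have hu0 : u ≠ 0 := by rintro h; rw [h, mul_zero] at hqu; exact hq hqu
  have htu := translateVars_ne_zero hu0
  have hlin :
      (Polynomial.C (X j) + Polynomial.X : Polynomial (MvPolynomial ι K)).natDegree = 1 := by
    rw [add_comm]; exact Polynomial.natDegree_X_add_C _
  -- The translate of `y_j` is `y_j + s`, of degree one in `s`, and degrees add over a domain.
  have hdeg : (translateVars ι K q).natDegree = b + (translateVars ι K u).natDegree := by
    have : translateVars ι K q
        = (Polynomial.C (X j) + Polynomial.X) ^ b * translateVars ι K u := by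
      conv_lhs => rw [hqu]
      simp [translateVars]
    rw [this, Polynomial.natDegree_mul (pow_ne_zero _ fun h => by simp [h] at hlin) htu,
      Polynomial.natDegree_pow, hlin, mul_one]
  have hbD : b ≤ D := by
    obtain ⟨c, hc⟩ := support_nonempty.2 hq
    exact (hb c hc).trans (hD c hc)
  -- Division lowers the degree in `s` by `b`; killing `y_j`, which has exponent at most `D - b` in
  -- the quotient, raises it by at most `D - b`. This is why `b` counts twice.
  refine ⟨by omega, killVar j u, ?_, fun c => by rw [coeff_killVar, hu_coeff]⟩
  have hcu : ∀ c ∈ u.support, c j ≤ D - b := by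
    intro c hc
    rw [mem_support_iff, hu_coeff] at hc
    have := hD _ (mem_support_iff.2 hc)
    simp at this
    omega
  have := natDegree_negParam_le j (translateVars ι K u) (degreeOf_coeff_translateVars j u hcu)
  rw [← translateVars_killVar] at this
  omega

end Translation

/-! ### Lattice words from translation invariance -/

section TranslationInvariance

variable {K : Type*} [Field K]

theorem filter_le_eq_filter_succ_le_add_single (b : ℕ →₀ ℕ) (r : ℕ) :
    b.filter (r ≤ ·) = b.filter (r + 1 ≤ ·) + Finsupp.single r (b r) := by
  ext l
  simp only [Finsupp.add_apply, Finsupp.filter_apply, Finsupp.single_apply]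
  rcases lt_trichotomy l r with h | h | h
  · simp [show ¬ r ≤ l by omega, show ¬ r + 1 ≤ l by omega, show r ≠ l by omega]
  · simp [h]
  · simp [show r ≤ l by omega, show r + 1 ≤ l by omega, show r ≠ l by omega]

/-- The exponent vector `b` of a translation invariant polynomial that is least when exponents are
compared from the largest variable downwards is a lattice word. -/
theorem sum_Ico_le_of_translation_invariant {q : MvPolynomial ℕ K}
    (hq : translateVars ℕ K q = Polynomial.C q) {b D : ℕ →₀ ℕ} (hb : b ∈ q.support)
    (hmin : ∀ c ∈ q.support, c ≠ b → ∃ l, b l < c l ∧ ∀ l', l < l' → c l' = b l')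
    (hD : ∀ c ∈ q.support, c ≤ D) (L : ℕ) (hL : ∀ l, L ≤ l → D l = 0) (j : ℕ) (hj : j < L) :
    ∑ l ∈ Finset.Ico j L, b l ≤ ∑ l ∈ Finset.Ico (j + 1) L, (D l - b l) := by
  classical
  have hbD : ∀ l, b l ≤ D l := hD b hb
  -- One peeling. Here `g` is what remains of `q` after dividing by `y_l ^ b l` and setting `y_l =
  -- 0` for all `l > r`; its degree in `s` is at most the sum of `D l - 2 * b l` over these `l`.
  have key : ∀ r, r < L → ∀ g : MvPolynomial ℕ K,
      (∀ c, g.coeff c = if ∀ l, r + 1 ≤ l → c l = 0 then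
        q.coeff (c + b.filter (r + 1 ≤ ·)) else 0) →
      (translateVars ℕ K g).natDegree + 2 * ∑ l ∈ Finset.Ico (r + 1) L, b l
        ≤ ∑ l ∈ Finset.Ico (r + 1) L, D l →
      b r + 2 * ∑ l ∈ Finset.Ico (r + 1) L, b l ≤ ∑ l ∈ Finset.Ico (r + 1) L, D l ∧
      ∃ g' : MvPolynomial ℕ K, (∀ c, g'.coeff c = if ∀ l, r ≤ l → c l = 0 then
        q.coeff (c + b.filter (r ≤ ·)) else 0) ∧
      (translateVars ℕ K g').natDegree + 2 * ∑ l ∈ Finset.Ico r L, b l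
        ≤ ∑ l ∈ Finset.Ico r L, D l := by
    intro r hr g hg hdeg
    have hsupp : ∀ c ∈ g.support, (∀ l, r + 1 ≤ l → c l = 0) ∧
        c + b.filter (r + 1 ≤ ·) ∈ q.support := by
      intro c hc
      rw [mem_support_iff, hg] at hc
      split_ifs at hc with h
      · exact ⟨h, mem_support_iff.2 hc⟩
      · exact absurd rfl hc
    have hval : ∀ c : ℕ →₀ ℕ, (c + b.filter (r + 1 ≤ ·)) r = c r := by
      intro c; simp
    -- With the removed exponents restored, a monomial of `g` agrees with `b` above `r`, so by
    -- minimality of `b` its last difference from `b` is at `r`, upwards, or below `r`.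
    have h1 : ∀ c ∈ g.support, b r ≤ c r := by
      intro c hc
      obtain ⟨h0, h⟩ := hsupp c hc
      by_cases hcb : c + b.filter (r + 1 ≤ ·) = b
      · rw [← hval c, hcb]
      · obtain ⟨l, hl, hl'⟩ := hmin _ h hcb
        rcases lt_trichotomy l r with h2 | h2 | h2
        · rw [← hl' r h2, hval]
        · rw [h2, hval] at hl; exact hl.le
        · have h3 : r + 1 ≤ l := h2
          rw [Finsupp.add_apply, h0 l h3, zero_add, Finsupp.filter_apply_pos _ _ h3] at hl
          exact absurd hl (lt_irrefl _)
    have h2 : ∀ c ∈ g.support, c r ≤ D r := by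
      intro c hc
      rw [← hval]
      exact hD _ (hsupp c hc).2 r
    have hg0 : g ≠ 0 := by
      intro h
      have h3 := hg (b.filter fun l => ¬ r + 1 ≤ l)
      rw [h, coeff_zero, if_pos fun l hl => Finsupp.filter_apply_neg (¬ r + 1 ≤ ·) _ (not_not.2 hl),
        add_comm, Finsupp.filter_add_filter_not] at h3
      exact (mem_support_iff.1 hb) h3.symm
    obtain ⟨h3, g', h4, h5⟩ := exists_peel r le_rfl h1 h2 hg0
    rw [Finset.sum_eq_sum_Ico_succ_bot hr, Finset.sum_eq_sum_Ico_succ_bot hr]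
    refine ⟨by omega, g', fun c => ?_, by omega⟩
    rw [h5, hg]
    by_cases hc : ∀ l, r ≤ l → c l = 0
    · have hc' : ∀ l, r + 1 ≤ l → (c + Finsupp.single r (b r)) l = 0 := by
        intro l hl
        simp [hc l (by omega), show r ≠ l by omega]
      rw [if_pos (hc r le_rfl), if_pos hc', if_pos hc, filter_le_eq_filter_succ_le_add_single b r]
      congr 1
      abel
    · rw [if_neg hc]
      split_ifs with h6 h7
      · refine absurd (fun l hl => ?_) hc
        rcases hl.eq_or_lt with h8 | h8
        · exact h8 ▸ h6
        · simpa [show r ≠ l by omega] using h7 l h8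
      · rfl
      · rfl
  have hbL : b.filter (L ≤ ·) = 0 := by
    ext l
    by_cases h : L ≤ l
    · have := hbD l
      simp [h]; have := hL l h; omega
    · simp [h]
  -- The descent starts at `L`, where nothing has been peeled and translation invariance makes the
  -- degree in `s` zero.
  have hex : ∀ i, i ≤ L → ∃ g : MvPolynomial ℕ K, (∀ c, g.coeff c = if ∀ l, L - i ≤ l → c l = 0 then
        q.coeff (c + b.filter (L - i ≤ ·)) else 0) ∧
      (translateVars ℕ K g).natDegree + 2 * ∑ l ∈ Finset.Ico (L - i) L, b l
        ≤ ∑ l ∈ Finset.Ico (L - i) L, D l := by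
    intro i
    induction i with
    | zero =>
      intro _
      refine ⟨q, fun c => ?_, by simp [hq]⟩
      simp only [Nat.sub_zero, hbL, add_zero]
      split_ifs with h
      · rfl
      · by_contra hc
        refine h fun l hl => ?_
        have := hD c (mem_support_iff.2 hc) l
        have := hL l hl
        omega
    | succ i ih =>
      intro hi
      obtain ⟨g, h1, h2⟩ := ih (by omega)
      have h3 : L - i = L - (i + 1) + 1 := by omega
      rw [h3] at h2
      simp only [h3] at h1
      exact (key (L - (i + 1)) (by omega) g h1 h2).2
  obtain ⟨g, h1, h2⟩ := hex (L - (j + 1)) (by omega)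
  have h3 : L - (L - (j + 1)) = j + 1 := by omega
  rw [h3] at h2
  simp only [h3] at h1
  -- At `j` itself only the bound of `b j` by the remaining degree in `s` is used; hence `j` on one
  -- side of the claim and `j + 1` on the other.
  have h4 := (key j hj g h1 h2).1
  rw [Finset.sum_tsub_distrib _ fun l _ => hbD l, Finset.sum_eq_sum_Ico_succ_bot hj]
  omega

end TranslationInvariance

/-! ### Polynomials invariant under shears -/

section Shear

variable {σ : Type} (x y : ℕ → σ)

/-- Invariance of `f` under `y_l ↦ y_l + s x_l` for all `l`, simultaneously. -/
def IsShearInvariant (f : MvPolynomial σ ℂ) : Prop :=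
  ∀ (B : Type) [CommRing B] [Algebra ℂ B] (g g' : σ → B) (s : B),
    (∀ l, g' (y l) = g (y l) + s * g (x l)) → (∀ v, v ∉ Set.range y → g' v = g v) →
    aeval g' f = aeval g f

variable {x y}

/-- Invariance is the equality of two algebra homomorphisms at `f`, and an equalizer is a
subalgebra. -/
theorem IsShearInvariant.of_mem_adjoin {S : Set (MvPolynomial σ ℂ)}
    (hS : ∀ f ∈ S, IsShearInvariant x y f) {f : MvPolynomial σ ℂ} (hf : f ∈ Algebra.adjoin ℂ S) :
    IsShearInvariant x y f := by
  intro B _ _ g g' s h1 h2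
  have : S ⊆ AlgHom.equalizer (aeval (R := ℂ) g') (aeval g) := fun f hf => hS f hf B g g' s h1 h2
  exact Algebra.adjoin_le this hf

variable (x y) in
/-- The substitution `y_l ↦ c_l x_l` where the `c_l` are new variables, on the single variables. -/
noncomputable def ratioVar (v : σ) : MvPolynomial σ (MvPolynomial ℕ ℂ) :=
  monomial (Finsupp.single (Function.extend y x id v) 1)
    (monomial (Function.extend y (fun l => Finsupp.single l 1) 0 v) 1)

/-- Each `y_l` is counted as an `x_l`, and its exponent is remembered by `c_l` in the coefficient
ring. -/
theorem aeval_ratioVar_monomial (hy : Function.Injective y) (u : σ →₀ ℕ) (c : ℂ) :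
    aeval (ratioVar x y) (monomial u c) = monomial (u.mapDomain (Function.extend y x id))
      (monomial (u.comapDomain y hy.injOn) c) := by
  classical
  induction u using Finsupp.induction_linear generalizing c with
  | zero =>
    rw [Finsupp.mapDomain_zero, Finsupp.comapDomain_zero, aeval_monomial, Finsupp.prod_zero_index,
      mul_one]
    rfl
  | add f g hf hg =>
    have : (monomial (f + g) c : MvPolynomial σ ℂ) = monomial f c * monomial g 1 := by
      rw [monomial_mul, mul_one]
    rw [this, map_mul, hf, hg, monomial_mul, monomial_mul, mul_one, Finsupp.mapDomain_add,
      Finsupp.comapDomain_add_of_injective hy]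
  | single v k =>
    rw [aeval_monomial, Finsupp.prod_single_index (by simp), ratioVar, monomial_pow, monomial_pow,
      one_pow, Finsupp.mapDomain_single, Finsupp.smul_single, smul_eq_mul, mul_one,
      IsScalarTower.algebraMap_apply ℂ (MvPolynomial ℕ ℂ) (MvPolynomial σ (MvPolynomial ℕ ℂ)),
      algebraMap_eq, algebraMap_eq, C_mul_monomial, C_mul_monomial, mul_one]
    congr 2
    by_cases hv : ∃ l, y l = v
    · obtain ⟨l, rfl⟩ := hv
      rw [hy.extend_apply, Finsupp.comapDomain_single]
      simp
    · rw [Function.extend_apply' _ _ _ hv]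
      have : Finsupp.comapDomain y (Finsupp.single v k) hy.injOn = 0 := by
        ext l
        have : v ≠ y l := fun h => hv ⟨l, h.symm⟩
        simp [this]
      rw [this, Pi.zero_apply, smul_zero]

theorem mapDomain_extend_apply_left (hx : Function.Injective x) (hy : Function.Injective y)
    (hxy : ∀ l l', x l ≠ y l') (u : σ →₀ ℕ) (l : ℕ) :
    u.mapDomain (Function.extend y x id) (x l) = u (x l) + u (y l) := by
  classical
  induction u using Finsupp.induction_linear with
  | zero => simp
  | add f g hf hg => rw [Finsupp.mapDomain_add, Finsupp.add_apply, hf, hg]; simp; abel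
  | single v k =>
    rw [Finsupp.mapDomain_single]
    by_cases hv : ∃ l, y l = v
    · obtain ⟨l', rfl⟩ := hv
      rw [hy.extend_apply]
      simp [Finsupp.single_apply, hx.eq_iff, hy.eq_iff, (hxy _ _).symm]
    · rw [Function.extend_apply' _ _ _ hv]
      have : v ≠ y l := fun h => hv ⟨l, h.symm⟩
      simp [Finsupp.single_apply, this]

theorem mapDomain_extend_apply_of_notMem (hy : Function.Injective y)
    (u : σ →₀ ℕ) {v : σ} (hx : v ∉ Set.range x) (hvy : v ∉ Set.range y) :
    u.mapDomain (Function.extend y x id) v = u v := by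
  classical
  induction u using Finsupp.induction_linear with
  | zero => simp
  | add f g hf hg => rw [Finsupp.mapDomain_add, Finsupp.add_apply, hf, hg]; simp
  | single w k =>
    rw [Finsupp.mapDomain_single]
    by_cases hw : ∃ l, y l = w
    · obtain ⟨l', rfl⟩ := hw
      rw [hy.extend_apply, Finsupp.single_eq_of_ne, Finsupp.single_eq_of_ne]
      · exact fun h => hvy ⟨l', h.symm⟩
      · exact fun h => hx ⟨l', h.symm⟩
    · rw [Function.extend_apply' _ _ _ hw]
      rfl

/-- The shear keeps `x_l` and sends the ratio `c_l = y_l / x_l` to `c_l + s`; compare the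
coefficients of a fixed monomial in the remaining variables. -/
theorem translateVars_coeff_ratio (hy : Function.Injective y) (hxy : ∀ l l', x l ≠ y l')
    {f : MvPolynomial σ ℂ} (hf : IsShearInvariant x y f) (u : σ →₀ ℕ) :
    translateVars ℕ ℂ ((aeval (ratioVar x y) f).coeff u)
      = Polynomial.C ((aeval (ratioVar x y) f).coeff u) := by
  classical
  set ιC : MvPolynomial ℕ ℂ →ₐ[ℂ] Polynomial (MvPolynomial ℕ ℂ) :=
    Polynomial.CAlgHom
  have key := hf _ (fun v => MvPolynomial.mapAlgHom ιC (ratioVar x y v))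
    (fun v => MvPolynomial.mapAlgHom (translateVars ℕ ℂ) (ratioVar x y v))
    (MvPolynomial.C Polynomial.X) (fun l => ?_) (fun v hv => ?_)
  · rw [← comp_aeval_apply, ← comp_aeval_apply] at key
    have := congrArg (coeff u) key
    rw [mapAlgHom_apply, mapAlgHom_apply, coeff_map, coeff_map] at this
    exact this
  · have hxl : ¬ ∃ l', y l' = x l := fun ⟨l', h⟩ => hxy l l' h.symm
    simp only [mapAlgHom_apply, ratioVar, map_monomial, hy.extend_apply,
      Function.extend_apply' _ _ _ hxl, id, C_mul_monomial, ← map_add]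
    congr 1
    have h1 : translateVars ℕ ℂ (monomial (Finsupp.single l 1) 1)
        = Polynomial.C (X l) + Polynomial.X :=
      aeval_X _ l
    have h2 : ∀ a, ιC a = Polynomial.C a := fun _ => rfl
    simp [h1, h2, X]
  · simp only [mapAlgHom_apply, ratioVar, map_monomial, Function.extend_apply' _ _ _ hv]
    congr 1
    simp

theorem coeff_coeff_ratio (hy : Function.Injective y) (f : MvPolynomial σ ℂ) (u : σ →₀ ℕ)
    (b : ℕ →₀ ℕ) [DecidableEq (σ →₀ ℕ)] :
    ((aeval (ratioVar x y) f).coeff u).coeff b = ∑ m ∈ f.support,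
      if m.mapDomain (Function.extend y x id) = u ∧ m.comapDomain y hy.injOn = b then
        f.coeff m else 0 := by
  classical
  conv_lhs => rw [f.as_sum, map_sum, coeff_sum, coeff_sum]
  refine Finset.sum_congr rfl fun m _ => ?_
  rw [aeval_ratioVar_monomial hy, coeff_monomial]
  by_cases h : m.mapDomain (Function.extend y x id) = u
  · simp [h, coeff_monomial]
  · simp [h]

/-- Distinct monomials stay distinct under the substitution `y_l = c_l x_l`, so nothing cancels. -/
theorem eq_of_mapDomain_extend_eq (hx : Function.Injective x) (hy : Function.Injective y)
    (hxy : ∀ l l', x l ≠ y l') {m m' : σ →₀ ℕ}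
    (h : m.mapDomain (Function.extend y x id) = m'.mapDomain (Function.extend y x id))
    (h' : ∀ l, m (y l) = m' (y l)) : m = m' := by
  ext v
  by_cases hvy : v ∈ Set.range y
  · obtain ⟨l, rfl⟩ := hvy
    exact h' l
  by_cases hvx : v ∈ Set.range x
  · obtain ⟨l, rfl⟩ := hvx
    have := DFunLike.congr_fun h (x l)
    rw [mapDomain_extend_apply_left hx hy hxy, mapDomain_extend_apply_left hx hy hxy, h' l] at this
    omega
  · have := DFunLike.congr_fun h v
    rwa [mapDomain_extend_apply_of_notMem hy _ hvx hvy,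
      mapDomain_extend_apply_of_notMem hy _ hvx hvy] at this

/-- A maximal exponent vector of a shear invariant polynomial satisfies the lattice word condition
for the pairs `x_l, y_l`. -/
theorem IsShearInvariant.sum_Ico_le [LinearOrder σ] (hx : Function.Injective x)
    (hy : StrictMono y) (hlt : ∀ l, x l < y l) (hxy : ∀ l l', x l ≠ y l')
    {f : MvPolynomial σ ℂ} (hf : IsShearInvariant x y f) {m : σ →₀ ℕ} (hm : m ∈ f.support)
    (hmax : ∀ m' ∈ f.support, m' ≠ m → ∃ v, m v < m' v ∧ ∀ w, v < w → m' w = m w)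
    {L : ℕ} (hL : ∀ l, L ≤ l → m (x l) = 0 ∧ m (y l) = 0) {j : ℕ} (hj : j < L) :
    ∑ l ∈ Finset.Ico j L, m (y l) ≤ ∑ l ∈ Finset.Ico (j + 1) L, m (x l) := by
  classical
  set u := m.mapDomain (Function.extend y x id) with hu
  have hyi := hy.injective
  set b := m.comapDomain y hyi.injOn with hb
  set D := u.comapDomain x hx.injOn with hD
  set q := (aeval (ratioVar x y) f).coeff u with hq
  have hDval : ∀ l, D l = m (x l) + m (y l) := fun l => by
    rw [hD, Finsupp.comapDomain_apply, hu, mapDomain_extend_apply_left hx hyi hxy]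
  have hqb : q.coeff b = f.coeff m := by
    rw [hq, coeff_coeff_ratio hyi, Finset.sum_eq_single m]
    · simp [hu, hb]
    · intro m' _ hne
      refine if_neg fun h => hne (eq_of_mapDomain_extend_eq hx hyi hxy h.1 fun l => ?_)
      exact DFunLike.congr_fun h.2 l
    · exact fun h => absurd hm h
  have hsupp : ∀ c ∈ q.support, ∃ m' ∈ f.support,
      m'.mapDomain (Function.extend y x id) = u ∧ m'.comapDomain y hyi.injOn = c := by
    intro c hc
    by_contra hcon
    push Not at hcon
    refine mem_support_iff.1 hc ?_
    rw [hq, coeff_coeff_ratio hyi]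
    exact Finset.sum_eq_zero fun m' hm' => if_neg fun h => hcon m' hm' h.1 h.2
  have main := sum_Ico_le_of_translation_invariant (q := q) (b := b) (D := D)
    (translateVars_coeff_ratio hyi hxy hf u)
    (by rw [mem_support_iff, hqb]; exact mem_support_iff.1 hm)
    (fun c hc hne => ?_) (fun c hc l => ?_) L (fun l hl => ?_) j hj
  · convert main using 2 with l _ l _
    · rw [hb, Finsupp.comapDomain_apply]
    · rw [hDval, hb, Finsupp.comapDomain_apply, Nat.add_sub_cancel]
  · obtain ⟨m', hm', h1, rfl⟩ := hsupp c hc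
    obtain ⟨v, hv, hv'⟩ := hmax m' hm' (by rintro rfl; exact hne rfl)
    -- The two vectors have the same total on each pair `x_l, y_l` and agree off the pairs. A last
    -- difference at `x_l` would force one at the later `y_l`, so it occurs at some `y_l`, that is,
    -- in the exponents of the `c_l`.
    have hsum : ∀ l, m' (x l) + m' (y l) = m (x l) + m (y l) := fun l => by
      rw [← mapDomain_extend_apply_left hx hyi hxy, ← mapDomain_extend_apply_left hx hyi hxy, h1]
    have hvr : v ∈ Set.range y := by
      by_contra hvy
      by_cases hvx : v ∈ Set.range x
      · obtain ⟨l, rfl⟩ := hvx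
        have h2 := hv' _ (hlt l)
        have h3 := hsum l
        omega
      · have h2 := DFunLike.congr_fun h1 v
        rw [hu, mapDomain_extend_apply_of_notMem hyi _ hvx hvy,
          mapDomain_extend_apply_of_notMem hyi _ hvx hvy] at h2
        omega
    obtain ⟨l, rfl⟩ := hvr
    exact ⟨l, hv, fun l' hl' => hv' _ (hy hl')⟩
  · obtain ⟨m', hm', h1, rfl⟩ := hsupp c hc
    rw [hD, Finsupp.comapDomain_apply, Finsupp.comapDomain_apply, ← h1,
      mapDomain_extend_apply_left hx hyi hxy]
    omega
  · rw [hDval]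
    have := hL l hl
    omega

end Shear

/-! ### Shear invariance of the semi-infinite Plücker algebra -/

section Plucker

variable {p n : ℕ}

/-- The variable in row `i` at position `j`, where the position of `z_{i,c}^{(k)}` is `k n + c`. -/
def posVar [NeZero n] (i : Fin p) (j : ℕ) : ZVar p n := ⟨i, Fin.ofNat n j, j / n⟩

namespace ZVar

/-- The position `k n + c` of the variable `z_{i,c}^{(k)}`. -/
def pos (v : ZVar p n) : ℕ := v.level * n + v.col

theorem posVar_pos [NeZero n] (v : ZVar p n) : posVar v.row v.pos = v := by
  have hn : 0 < n := Nat.pos_of_neZero n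
  ext
  · rfl
  · simp [posVar, pos, Nat.add_mod, Nat.mod_eq_of_lt v.col.isLt]
  · simp only [posVar, pos]
    rw [mul_comm, Nat.mul_add_div hn, Nat.div_eq_of_lt v.col.isLt, add_zero]

theorem pos_posVar [NeZero n] (i : Fin p) (j : ℕ) : (posVar i j : ZVar p n).pos = j := by
  simp only [posVar, pos, Fin.val_ofNat]
  rw [mul_comm]
  exact Nat.div_add_mod j n

/-- The sorting key of the diagonal order: first the position, then the row, downwards. -/
def diagKey (v : ZVar p n) : ℕ ×ₗ ℕ := toLex (v.pos, p - 1 - v.row)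

theorem diagKey_injective : Function.Injective (diagKey : ZVar p n → ℕ ×ₗ ℕ) := by
  intro v w h
  have : NeZero n := ⟨by have := v.col.isLt; omega⟩
  have h1 := congrArg ofLex h
  simp only [diagKey, ofLex_toLex, Prod.mk.injEq] at h1
  have h2 : v.row = w.row := by
    have := v.row.isLt
    have := w.row.isLt
    ext
    omega
  rw [← posVar_pos v, ← posVar_pos w, h1.1, h2]

variable (p n) in
/-- The ordering of the variables by position and, in the same position, by decreasing row. -/
@[reducible] noncomputable def diagLinearOrder : LinearOrder (ZVar p n) :=
  LinearOrder.lift' diagKey diagKey_injective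

theorem diag_lt_iff {v w : ZVar p n} :
    (diagLinearOrder p n).lt v w ↔ v.pos < w.pos ∨ v.pos = w.pos ∧ w.row < v.row := by
  have : (diagLinearOrder p n).lt v w ↔ diagKey v < diagKey w := Iff.rfl
  rw [this, diagKey, diagKey, Prod.Lex.toLex_lt_toLex]
  have := v.row.isLt
  have := w.row.isLt
  simp only [Fin.lt_def]
  omega

end ZVar

theorem posVar_injective [NeZero n] (i : Fin p) :
    Function.Injective (posVar i : ℕ → ZVar p n) := fun j j' h => by
  rw [← ZVar.pos_posVar (n := n) i j, h, ZVar.pos_posVar]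

theorem aeval_coeffMinor {B : Type*} [CommRing B] [Algebra ℂ B] (g : ZVar p n → B)
    (I : Fin p → Fin n) (k : ℕ) :
    aeval g (coeffMinor I k) = PowerSeries.coeff k
      (Matrix.of fun i t => PowerSeries.mk fun l => g ⟨i, I t, l⟩).det := by
  have h1 : aeval g (coeffMinor I k) = PowerSeries.coeff k (PowerSeries.map
      (aeval (R := ℂ) g).toRingHom ((seriesMatrix p n).submatrix id I).det) := by
    rw [PowerSeries.coeff_map]
    rfl
  rw [h1, RingHom.map_det]
  congr 2
  ext i t : 1
  ext l
  simp [seriesMatrix]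

/-- This is the row operation that adds `s t^e` times row `i'` to row `i`; multiplication by `t^e`
shifts positions by `e * n`. -/
theorem coeffMinor_isShearInvariant [NeZero n] {i i' : Fin p} (hi : i ≠ i') (e : ℕ)
    (I : Fin p → Fin n) (k : ℕ) :
    IsShearInvariant (fun l => posVar i' l) (fun l => posVar i (l + e * n)) (coeffMinor I k) := by
  intro B _ _ g g' s h1 h2
  have hn : 0 < n := Nat.pos_of_neZero n
  rw [aeval_coeffMinor, aeval_coeffMinor]
  set M : Matrix (Fin p) (Fin p) (PowerSeries B) :=
    Matrix.of fun i t => PowerSeries.mk fun l => g ⟨i, I t, l⟩ with hM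
  rw [← Matrix.det_updateRow_add_smul_self M hi (PowerSeries.C s * PowerSeries.X ^ e)]
  congr 2
  ext r t : 1
  ext l
  rw [Matrix.of_apply, PowerSeries.coeff_mk]
  by_cases hr : r = i
  · subst hr
    rw [Matrix.updateRow_self, Pi.add_apply, Pi.smul_apply, smul_eq_mul, mul_assoc, map_add,
      PowerSeries.coeff_C_mul, PowerSeries.coeff_X_pow_mul', hM, Matrix.of_apply, Matrix.of_apply,
      PowerSeries.coeff_mk, PowerSeries.coeff_mk]
    split_ifs with hle
    · have hY : (⟨r, I t, l⟩ : ZVar p n)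
          = posVar r ((⟨i', I t, l - e⟩ : ZVar p n).pos + e * n) := by
        rw [← ZVar.posVar_pos ⟨r, I t, l⟩]
        congr 1
        simp only [ZVar.pos]
        obtain ⟨l', rfl⟩ := Nat.exists_eq_add_of_le hle
        rw [Nat.add_sub_cancel_left]
        ring
      have hX : posVar i' (ZVar.pos ⟨i', I t, l - e⟩) = (⟨i', I t, l - e⟩ : ZVar p n) :=
        ZVar.posVar_pos ⟨i', I t, l - e⟩
      rw [hY, h1]
      simp only [hX]
    -- At levels below `e` the added multiple has no coefficient, and the variable is not among the
    -- `y_l`.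
    · rw [mul_zero, add_zero]
      refine h2 _ ?_
      rintro ⟨l', h⟩
      have h3 := congrArg ZVar.level h
      simp only [posVar] at h3
      rw [Nat.add_mul_div_right _ _ hn] at h3
      exact hle (h3 ▸ Nat.le_add_left e _)
  · rw [Matrix.updateRow_ne hr, hM, Matrix.of_apply, PowerSeries.coeff_mk]
    refine h2 _ ?_
    rintro ⟨l', h⟩
    exact hr (congrArg ZVar.row h).symm

theorem isShearInvariant_of_mem_semiInfinitePlucker [NeZero n] {i i' : Fin p} (hi : i ≠ i')
    (e : ℕ) {f : MvPolynomial (ZVar p n) ℂ} (hf : f ∈ semiInfinitePlucker p n) :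
    IsShearInvariant (fun l => posVar i' l) (fun l => posVar i (l + e * n)) f := by
  refine IsShearInvariant.of_mem_adjoin ?_ hf
  rintro _ ⟨I, k, rfl⟩
  exact coeffMinor_isShearInvariant hi e I k

end Plucker

/-! ### The expansion of the minors and the grading -/

section Plucker

variable {p n : ℕ}

/-- The exponent vector of the product of one variable from each row. -/
noncomputable def transversalExp (c : Fin p → Fin n) (l : Fin p → ℕ) : ZVar p n →₀ ℕ :=
  ∑ i, Finsupp.single ⟨i, c i, l i⟩ 1

theorem coeffMinor_eq_sum (I : Fin p → Fin n) (k : ℕ) :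
    coeffMinor I k = ∑ π : Equiv.Perm (Fin p), ∑ κ ∈ Finset.finsuppAntidiag Finset.univ k,
      monomial (transversalExp (fun i => I (π i)) κ) (((Equiv.Perm.sign π : ℤ) : ℂ)) := by
  classical
  rw [coeffMinor, ← Matrix.det_transpose, Matrix.det_apply', map_sum]
  refine Finset.sum_congr rfl fun π _ => ?_
  have h1 : (((Equiv.Perm.sign π : ℤ) : PowerSeries (MvPolynomial (ZVar p n) ℂ)))
      = PowerSeries.C (C ((Equiv.Perm.sign π : ℤ) : ℂ)) := by simp
  rw [h1, PowerSeries.coeff_C_mul, PowerSeries.coeff_prod, Finset.mul_sum]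
  refine Finset.sum_congr rfl fun κ _ => ?_
  have h2 : (∏ i, PowerSeries.coeff (κ i) (((seriesMatrix p n).submatrix id I).transpose (π i) i))
      = monomial (transversalExp (fun i => I (π i)) κ) 1 := by
    rw [transversalExp, monomial_sum_one]
    refine Finset.prod_congr rfl fun i _ => ?_
    simp [seriesMatrix, X]
  rw [h2, C_mul_monomial, mul_one]

/-- The weight of a variable: it records the row and the level. -/
def gradeWeight (v : ZVar p n) : (Fin p → ℕ) × ℕ := (Pi.single v.row 1, v.level)

theorem weight_transversalExp (c : Fin p → Fin n) (l : Fin p → ℕ) :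
    Finsupp.weight gradeWeight (transversalExp c l) = (fun _ => 1, ∑ i, l i) := by
  rw [transversalExp, map_sum]
  simp only [Finsupp.weight_single, one_smul, gradeWeight]
  ext i
  · simp [Prod.fst_sum, Finset.sum_apply, Pi.single_apply]
  · simp [Prod.snd_sum]

theorem degree_eq_sum_weight (m : ZVar p n →₀ ℕ) :
    m.degree = ∑ i, (Finsupp.weight gradeWeight m).1 i := by
  classical
  induction m using Finsupp.induction_linear with
  | zero => simp
  | add f g hf hg => rw [map_add, map_add, hf, hg, ← Finset.sum_add_distrib]; rfl
  | single v k => simp [Finsupp.weight_single, gradeWeight, Pi.single_apply]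

theorem coeffMinor_isWeightedHomogeneous (I : Fin p → Fin n) (k : ℕ) :
    IsWeightedHomogeneous gradeWeight (coeffMinor I k) (fun _ => 1, k) := by
  classical
  rw [coeffMinor_eq_sum]
  refine IsWeightedHomogeneous.sum _ _ _ fun π _ => IsWeightedHomogeneous.sum _ _ _ fun κ hκ => ?_
  refine isWeightedHomogeneous_monomial _ _ _ ?_
  rw [weight_transversalExp, (Finset.mem_finsuppAntidiag.1 hκ).1]

/-- A minor has degree one in every row, and equality of the row degrees of all monomials passes to
sums and products. -/
theorem exists_weight_eq_of_mem_semiInfinitePlucker {f : MvPolynomial (ZVar p n) ℂ}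
    (hf : f ∈ semiInfinitePlucker p n) {m : ZVar p n →₀ ℕ} (hm : m ∈ f.support) :
    ∃ d, (Finsupp.weight gradeWeight m).1 = fun _ => d := by
  classical
  induction hf using Algebra.adjoin_induction generalizing m with
  | mem f hf =>
    obtain ⟨I, k, rfl⟩ := hf
    rw [coeffMinor_isWeightedHomogeneous I k (mem_support_iff.1 hm)]
    exact ⟨1, rfl⟩
  | algebraMap r =>
    have h := support_monomial_subset hm
    rw [Finset.mem_singleton.1 h]
    exact ⟨0, by simp; rfl⟩
  | add f g _ _ hf hg =>
    rcases Finset.mem_union.1 (support_add hm) with h | h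
    exacts [hf h, hg h]
  | mul f g _ _ hf hg =>
    obtain ⟨a, ha, b, hb, rfl⟩ := Finset.mem_add.1 (support_mul f g hm)
    obtain ⟨d, hd⟩ := hf ha
    obtain ⟨e, he⟩ := hg hb
    exact ⟨d + e, by rw [map_add, Prod.fst_add, hd, he]; rfl⟩

/-- The algebra is spanned by products of minors, which are homogeneous. -/
theorem weightedHomogeneousComponent_mem_semiInfinitePlucker {f : MvPolynomial (ZVar p n) ℂ}
    (hf : f ∈ semiInfinitePlucker p n) (ω : (Fin p → ℕ) × ℕ) :
    weightedHomogeneousComponent gradeWeight ω f ∈ semiInfinitePlucker p n := by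
  classical
  set S := {f | ∃ (I : Fin p → Fin n) (k : ℕ), f = coeffMinor I k} with hS
  have hmem : ∀ g ∈ Submonoid.closure S, g ∈ semiInfinitePlucker p n := fun g hg =>
    (Submonoid.closure_le.2 Algebra.subset_adjoin :
      Submonoid.closure S ≤ (semiInfinitePlucker p n).toSubmonoid) hg
  have hhom : ∀ g ∈ Submonoid.closure S, ∃ τ, IsWeightedHomogeneous gradeWeight g τ := by
    intro g hg
    induction hg using Submonoid.closure_induction with
    | mem g hg =>
      obtain ⟨I, k, rfl⟩ := hg
      exact ⟨_, coeffMinor_isWeightedHomogeneous I k⟩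
    | one => exact ⟨0, isWeightedHomogeneous_one _ _⟩
    | mul g h _ _ hg hh =>
      obtain ⟨a, ha⟩ := hg
      obtain ⟨b, hb⟩ := hh
      exact ⟨a + b, ha.mul hb⟩
  have hf' : f ∈ Submodule.span ℂ (Submonoid.closure S : Set (MvPolynomial (ZVar p n) ℂ)) := by
    rw [← Algebra.adjoin_eq_span]
    exact hf
  induction hf' using Submodule.span_induction with
  | mem g hg =>
    obtain ⟨τ, hτ⟩ := hhom g hg
    by_cases h : τ = ω
    · rw [← h, hτ.weightedHomogeneousComponent_same]
      exact hmem g hg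
    · rw [hτ.weightedHomogeneousComponent_ne _ (Ne.symm h)]
      exact zero_mem _
  | zero => simp
  | add g h hg hh ihg ihh =>
    have hsub : ∀ g ∈ Submodule.span ℂ (Submonoid.closure S : Set (MvPolynomial (ZVar p n) ℂ)),
        g ∈ semiInfinitePlucker p n := fun g hg => by
      rw [← Algebra.adjoin_eq_span] at hg
      exact hg
    rw [map_add]
    exact add_mem (ihg (hsub g hg)) (ihh (hsub h hh))
  | smul a g hg ih =>
    rw [map_smul]
    rw [← Algebra.adjoin_eq_span] at hg
    exact Subalgebra.smul_mem _ (ih hg) a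

end Plucker

/-! ### Standard monomials for the diagonal order -/

section Standard

variable {p n : ℕ} [NeZero n]

/-- The degree of the monomial `m` in the variables of row `i` at positions less than `j`. -/
noncomputable def rowCount (m : ZVar p n →₀ ℕ) (i : Fin p) (j : ℕ) : ℕ :=
  ∑ l ∈ Finset.range j, m (posVar i l)

theorem rowCount_zero_right (m : ZVar p n →₀ ℕ) (i : Fin p) : rowCount m i 0 = 0 := rfl

theorem rowCount_succ (m : ZVar p n →₀ ℕ) (i : Fin p) (j : ℕ) :
    rowCount m i (j + 1) = rowCount m i j + m (posVar i j) := Finset.sum_range_succ _ _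

theorem rowCount_mono (m : ZVar p n →₀ ℕ) (i : Fin p) : Monotone (rowCount m i) :=
  monotone_nat_of_le_succ fun j => by rw [rowCount_succ]; exact Nat.le_add_right _ _

theorem rowCount_add (m m' : ZVar p n →₀ ℕ) (i : Fin p) (j : ℕ) :
    rowCount (m + m') i j = rowCount m i j + rowCount m' i j := Finset.sum_add_distrib

theorem eq_of_rowCount_eq {m m' : ZVar p n →₀ ℕ} (h : ∀ i j, rowCount m i j = rowCount m' i j) :
    m = m' := by
  ext v
  have h1 := h v.row (v.pos + 1)
  rw [rowCount_succ, rowCount_succ, h v.row v.pos, ZVar.posVar_pos] at h1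
  omega

theorem exists_rowCount_eq_weight (m : ZVar p n →₀ ℕ) :
    ∃ L, ∀ i j, L ≤ j → rowCount m i j = (Finsupp.weight gradeWeight m).1 i := by
  classical
  induction m using Finsupp.induction_linear with
  | zero => exact ⟨0, fun i j _ => by simp [rowCount]⟩
  | add f g hf hg =>
    obtain ⟨L, hL⟩ := hf
    obtain ⟨L', hL'⟩ := hg
    refine ⟨max L L', fun i j h => ?_⟩
    rw [rowCount_add, hL i j (le_of_max_le_left h), hL' i j (le_of_max_le_right h), map_add]
    rfl
  | single v k =>
    refine ⟨v.pos + 1, fun i j h => ?_⟩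
    rw [Finsupp.weight_single, gradeWeight, Prod.smul_fst, Pi.smul_apply, smul_eq_mul, rowCount]
    dsimp only
    by_cases hi : i = v.row
    · subst hi
      rw [Pi.single_eq_same, mul_one, Finset.sum_eq_single v.pos]
      · rw [ZVar.posVar_pos, Finsupp.single_eq_same]
      · intro l _ hl
        refine Finsupp.single_eq_of_ne fun h => hl ?_
        rw [← h, ZVar.pos_posVar]
      · intro h'
        exact absurd (Finset.mem_range.2 h) h'
    · rw [Pi.single_eq_of_ne hi, mul_zero]
      refine Finset.sum_eq_zero fun l _ => Finsupp.single_eq_of_ne fun h => hi ?_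
      rw [← h]
      rfl

/-- The degree of `m` in the variables of the row after `i` at positions at most `j`, where the row
after the last one is the first one with positions shifted by `n`. -/
noncomputable def nextCount (m : ZVar p n →₀ ℕ) (i : Fin p) (j : ℕ) : ℕ :=
  if h : (i : ℕ) + 1 < p then rowCount m ⟨i + 1, h⟩ (j + 1)
  else rowCount m ⟨0, i.pos⟩ (j + 1 - n)

/-- The products `z_{0,x_0} ⋯ z_{p-1,x_{p-1}}` with positions `x_0 < ⋯ < x_{p-1} < x_0 + n` generate
the monoid of the exponent vectors that satisfy this condition. -/
def IsDiagStandard (m : ZVar p n →₀ ℕ) : Prop := ∀ i j, nextCount m i j ≤ rowCount m i j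

theorem sum_Ico_eq_rowCount_sub (m : ZVar p n →₀ ℕ) (i : Fin p) {a L : ℕ} (h : a ≤ L) :
    ∑ l ∈ Finset.Ico a L, m (posVar i l) = rowCount m i L - rowCount m i a := by
  have := Finset.sum_range_add_sum_Ico (fun l => m (posVar i l)) h
  unfold rowCount
  omega

/-- The leading monomial for the diagonal reverse lexicographic order is standard: the inequality
for row `i` comes from the shears that add multiples of row `i + 1` to it, or `t` times multiples of
the first row if `i` is the last. -/
theorem exists_isDiagStandard_mem_support {f : MvPolynomial (ZVar p n) ℂ}
    (hf : f ∈ semiInfinitePlucker p n) (hf0 : f ≠ 0) {ω : (Fin p → ℕ) × ℕ}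
    (hω : IsWeightedHomogeneous gradeWeight f ω) : ∃ m ∈ f.support, IsDiagStandard m := by
  classical
  have hn : 0 < n := Nat.pos_of_neZero n
  -- This shadows the PBW ordering: in this proof `<` on variables is the diagonal ordering.
  let _ : LinearOrder (ZVar p n) := ZVar.diagLinearOrder p n
  obtain ⟨m, hm, hlt⟩ := (MonOrder.degRevLex (ZVar p n)).exists_isInitialExp hf0
  refine ⟨m, hm, ?_⟩
  have hdeg : ∀ m' ∈ f.support, m'.degree = ∑ i, ω.1 i := fun m' hm' => by
    rw [degree_eq_sum_weight, hω (mem_support_iff.1 hm')]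
  have hmax : ∀ m' ∈ f.support, m' ≠ m → ∃ v, m v < m' v ∧ ∀ w, v < w → m' w = m w := by
    intro m' hm' hne
    rcases hlt m' hm' hne with h | h
    · rw [hdeg m' hm', hdeg m hm] at h
      exact absurd h (lt_irrefl _)
    · exact h.2
  obtain ⟨d, hd⟩ := exists_weight_eq_of_mem_semiInfinitePlucker hf hm
  obtain ⟨L, hL⟩ := exists_rowCount_eq_weight m
  simp only [hd] at hL
  have hzero : ∀ (i : Fin p) l, L ≤ l → m (posVar i l) = 0 := by
    intro i l hl
    have h1 := hL i (l + 1) (by omega)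
    rw [rowCount_succ, hL i l hl] at h1
    omega
  have hle : ∀ (i : Fin p) j, rowCount m i j ≤ d := fun i j => by
    rw [← hL i (max j L) (le_max_right _ _)]
    exact rowCount_mono m i (le_max_left _ _)
  -- The lattice word condition compares tails of two rows; as all rows have the same degree `d`, it
  -- turns into a comparison of heads.
  have key : ∀ (i i' : Fin p) (e : ℕ), i ≠ i' →
      (∀ l, (posVar i' l : ZVar p n) < posVar i (l + e * n)) →
      ∀ j, rowCount m i' (j + 1) ≤ rowCount m i (j + e * n) := by
    intro i i' e hi hlt j
    have h1 := (isShearInvariant_of_mem_semiInfinitePlucker hi e hf).sum_Ico_le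
      (posVar_injective i') (y := fun l => posVar i (l + e * n)) ?_ hlt ?_ hm hmax
      (L := L + j + 1) (fun l hl => ⟨hzero _ _ (by omega), hzero _ _ (le_trans (by omega)
        (Nat.le_add_right l (e * n)))⟩) (j := j) (by omega)
    · rw [sum_Ico_eq_rowCount_sub _ _ (by omega),
        Finset.sum_Ico_add' (fun l => m (posVar i l)) j (L + j + 1) (e * n),
        sum_Ico_eq_rowCount_sub _ _ (by omega), hL i _ (show L ≤ L + j + 1 + e * n by omega),
        hL i' _ (show L ≤ L + j + 1 by omega)] at h1
      have h2 := hle i' (j + 1)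
      omega
    · intro l l' hl
      refine ZVar.diag_lt_iff.2 (Or.inl ?_)
      simp only [ZVar.pos_posVar]
      omega
    · intro l l' h
      exact hi (congrArg ZVar.row h).symm
  intro i j
  rw [nextCount]
  split_ifs with h
  · have := key i ⟨i + 1, h⟩ 0 (fun h' => by have := congrArg Fin.val h'; simp at this)
      (fun l => ZVar.diag_lt_iff.2 (Or.inr ⟨by simp [ZVar.pos_posVar], by
        rw [Fin.lt_def]; exact Nat.lt_succ_self _⟩)) j
    simpa using this
  -- If there is only one row, it is its own successor and monotonicity replaces the shear.
  · by_cases hp : (i : ℕ) = 0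
    · have : (⟨0, i.pos⟩ : Fin p) = i := Fin.ext hp.symm
      rw [this]
      exact rowCount_mono m i (by omega)
    · by_cases hj : j + 1 ≤ n
      · rw [Nat.sub_eq_zero_of_le hj, rowCount_zero_right]
        exact Nat.zero_le _
      · obtain ⟨j', rfl⟩ := Nat.exists_eq_add_of_le (show n ≤ j by omega)
        have := key i ⟨0, i.pos⟩ 1 (fun h' => hp (congrArg Fin.val h'))
          (fun l => ZVar.diag_lt_iff.2 (Or.inl (by simp only [ZVar.pos_posVar]; omega))) j'
        rw [show n + j' + 1 - n = j' + 1 by omega, show n + j' = j' + 1 * n by omega]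
        exact this

end Standard

/-! ### The initial terms of the minors -/

section Plucker

variable {p n : ℕ}

theorem transversalExp_apply (c : Fin p → Fin n) (l : Fin p → ℕ) (v : ZVar p n)
    [Decidable (c v.row = v.col ∧ l v.row = v.level)] :
    transversalExp c l v = if c v.row = v.col ∧ l v.row = v.level then 1 else 0 := by
  classical
  rw [transversalExp, Finsupp.finsetSum_apply, Finset.sum_eq_single v.row]
  · rw [Finsupp.single_apply]
    congr 1
    simp [ZVar.ext_iff]
  · intro i _ hi
    refine Finsupp.single_eq_of_ne fun h => hi ?_
    rw [h]
  · simp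

theorem transversalExp_injective {c c' : Fin p → Fin n} {l l' : Fin p → ℕ}
    (h : transversalExp c l = transversalExp c' l') : c = c' ∧ l = l' := by
  classical
  have key : ∀ i, c i = c' i ∧ l i = l' i := by
    intro i
    have h1 := DFunLike.congr_fun h ⟨i, c i, l i⟩
    rw [transversalExp_apply, transversalExp_apply, if_pos ⟨rfl, rfl⟩] at h1
    split_ifs at h1 with h2
    exact ⟨h2.1.symm, h2.2.symm⟩
  exact ⟨funext fun i => (key i).1, funext fun i => (key i).2⟩

variable (p) in
/-- The bijection `t ↦ (k + t) mod p`. -/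
noncomputable def rowEquiv (k : ℕ) : Fin p ≃ Fin p :=
  Equiv.ofBijective (fun t => ⟨(k + t) % p, Nat.mod_lt _ t.pos⟩) <| by
    rw [← Finite.injective_iff_bijective]
    intro t t' h
    have h1 : (k + t) ≡ (k + t') [MOD p] := Fin.mk.inj_iff.1 h
    have h2 : (t : ℕ) ≡ t' [MOD p] := Nat.ModEq.add_left_cancel' k h1
    rw [Nat.ModEq, Nat.mod_eq_of_lt t.isLt, Nat.mod_eq_of_lt t'.isLt] at h2
    exact Fin.ext h2

theorem rowEquiv_val (k : ℕ) (t : Fin p) : (rowEquiv p k t : ℕ) = (k + t) % p := rfl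

/-- The remainders of `k, …, k + p - 1` modulo `p` permute `0, …, p - 1`. So the levels in `pbwExp`
add up to `k`. -/
theorem sum_add_div (k : ℕ) (hp : 0 < p) : ∑ t : Fin p, (k + t) / p = k := by
  have h1 : ∑ t : Fin p, (k + t) = ∑ t : Fin p, (p * ((k + t) / p) + (rowEquiv p k t : ℕ)) :=
    Finset.sum_congr rfl fun t _ => (Nat.div_add_mod _ _).symm
  rw [Finset.sum_add_distrib, Finset.sum_add_distrib,
    Equiv.sum_comp (rowEquiv p k) fun t => (t : ℕ), ← Finset.mul_sum] at h1
  simp only [Finset.sum_const, Finset.card_univ, Fintype.card_fin, smul_eq_mul] at h1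
  exact (Nat.eq_of_mul_eq_mul_left hp (Nat.add_right_cancel h1)).symm

/-- The exponent vector of the initial term of `D_I^{(k)}` for a PBW index `(I, k)`. -/
noncomputable def pbwExp (I : Fin p → Fin n) (k : ℕ) : ZVar p n →₀ ℕ :=
  ∑ t : Fin p, Finsupp.single ⟨rowEquiv p k t, I t, (k + t) / p⟩ 1

theorem pbwExp_eq_transversalExp (I : Fin p → Fin n) (k : ℕ) :
    pbwExp I k = transversalExp (fun i => I ((rowEquiv p k).symm i))
      (fun i => (k + (rowEquiv p k).symm i) / p) := by
  rw [transversalExp, ← Equiv.sum_comp (rowEquiv p k)]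
  simp only [Equiv.symm_apply_apply]
  rfl

/-- For distinct columns the terms of the expansion have distinct monomials, so there is no
cancellation. -/
theorem coeff_pbwExp_coeffMinor {I : Fin p → Fin n} (hI : Function.Injective I) (hp : 0 < p)
    (k : ℕ) : (coeffMinor I k).coeff (pbwExp I k)
      = ((Equiv.Perm.sign (rowEquiv p k).symm : ℤ) : ℂ) := by
  classical
  rw [coeffMinor_eq_sum, coeff_sum, Finset.sum_eq_single (rowEquiv p k).symm, coeff_sum,
    Finset.sum_eq_single (Finsupp.equivFunOnFinite.symm fun i => (k + (rowEquiv p k).symm i) / p)]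
  · rw [pbwExp_eq_transversalExp, coeff_monomial]
    exact if_pos rfl
  · intro κ _ hκ
    rw [pbwExp_eq_transversalExp, coeff_monomial, if_neg]
    intro h
    refine hκ (DFunLike.coe_injective ?_)
    exact (transversalExp_injective h).2
  · intro h
    refine absurd (Finset.mem_finsuppAntidiag.2 ⟨?_, Finset.subset_univ _⟩) h
    change ∑ i, (k + (rowEquiv p k).symm i) / p = k
    rw [Equiv.sum_comp (rowEquiv p k).symm fun t : Fin p => (k + t) / p, sum_add_div k hp]
  · intro π _ hπ
    rw [coeff_sum]
    refine Finset.sum_eq_zero fun κ _ => ?_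
    rw [pbwExp_eq_transversalExp, coeff_monomial, if_neg]
    intro h
    refine hπ (Equiv.ext fun i => hI ?_)
    exact congrFun (transversalExp_injective h).1 i
  · simp

theorem exists_of_mem_support_coeffMinor {I : Fin p → Fin n} {k : ℕ} {e : ZVar p n →₀ ℕ}
    (he : e ∈ (coeffMinor I k).support) : ∃ (π : Equiv.Perm (Fin p)) (κ : Fin p → ℕ),
      ∑ i, κ i = k ∧ e = transversalExp (fun i => I (π i)) κ := by
  classical
  by_contra hcon
  push Not at hcon
  refine mem_support_iff.1 he ?_
  rw [coeffMinor_eq_sum, coeff_sum]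
  refine Finset.sum_eq_zero fun π _ => ?_
  rw [coeff_sum]
  refine Finset.sum_eq_zero fun κ hκ => ?_
  rw [coeff_monomial, if_neg]
  exact fun h => hcon π κ (Finset.mem_finsuppAntidiag.1 hκ).1 h.symm

theorem residue_cast_lt (hn : 0 < n) (a : ℤ) : residue n a < n := by
  have h1 := Int.emod_lt_of_pos a (Int.natCast_pos.2 hn)
  have h2 := Int.emod_nonneg a (Int.natCast_pos.2 hn).ne'
  unfold residue
  omega

theorem residue_eq_of_modEq {a b : ℤ} (h : a ≡ b [ZMOD n]) : residue n a = residue n b := by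
  rw [residue, residue, h]

theorem residue_natCast {a : ℕ} (h : a < n) : residue n (a : ℤ) = a := by
  rw [residue, Int.emod_eq_of_lt (by omega) (by omega)]
  simp

theorem residue_modEq (hn : 0 < n) (a : ℤ) : (residue n a : ℤ) ≡ a [ZMOD n] := by
  have h2 := Int.emod_nonneg a (Int.natCast_pos.2 hn).ne'
  rw [residue, Int.toNat_of_nonneg h2]
  exact Int.mod_modEq a n

theorem residue_sub_of_le (hn : 0 < n) {a : ℤ} {t : ℕ} (h : t ≤ residue n a) :
    residue n (a - t) = residue n a - t := by
  have h1 := residue_cast_lt hn a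
  rw [← residue_natCast (show residue n a - t < n by omega)]
  refine residue_eq_of_modEq ?_
  rw [Nat.cast_sub h]
  exact ((residue_modEq hn a).sub_right _).symm

theorem residue_sub_of_lt (hn : 0 < n) {a : ℤ} {t : ℕ} (h : residue n a < t) (ht : t ≤ n) :
    residue n (a - t) = residue n a + n - t := by
  rw [← residue_natCast (show residue n a + n - t < n by omega)]
  refine residue_eq_of_modEq ?_
  rw [Nat.cast_sub (by omega), Nat.cast_add]
  refine Int.ModEq.sub_right _ ?_
  simpa using (residue_modEq hn a).symm

/-- Seen from the starting column `k + t`, column `t` is at least as near as each earlier column. It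
is at distance `0` if its shifted entry is below `p`. Otherwise an earlier entry is either larger,
or fixed below `t` and thus reached only after wrapping around. -/
theorem IsPBWTuple.residue_le {I : Fin p → Fin n} {k : ℕ} (hn : p < n)
    (h : IsPBWTuple fun j => residue n ((I j : ℤ) - (k : ℤ))) {s t : Fin p} (hst : s < t) :
    residue n ((I t : ℤ) - k - (t : ℕ)) ≤ residue n ((I s : ℤ) - k - (t : ℕ)) := by
  obtain ⟨hinj, hfix, hdec⟩ := h
  have ht := t.isLt
  have hst' : (s : ℕ) < t := hst
  have hbt := residue_cast_lt (n := n) (by omega) ((I t : ℤ) - k)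
  have hf1 : residue n ((I t : ℤ) - k) < p → residue n ((I t : ℤ) - k) = t := hfix t
  have hf2 : residue n ((I s : ℤ) - k) < p → residue n ((I s : ℤ) - k) = s := hfix s
  have hd : residue n ((I s : ℤ) - k) < residue n ((I t : ℤ) - k) →
      p ≤ residue n ((I s : ℤ) - k) → t < s := hdec t s
  generalize ((I t : ℤ) - k) = a at *
  generalize ((I s : ℤ) - k) = b at *
  by_cases h1 : residue n a < p
  · rw [residue_sub_of_le (by omega) (hf1 h1).ge, hf1 h1]
    omega
  · rw [residue_sub_of_le (by omega) (by omega)]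
    by_cases h2 : residue n b < p
    · rw [residue_sub_of_lt (a := b) (by omega) (by rw [hf2 h2]; exact hst') (by omega)]
      omega
    · rw [residue_sub_of_le (a := b) (by omega) (by omega)]
      have h3 : ¬ residue n b < residue n a := fun h3 => lt_asymm hst (hd h3 (by omega))
      omega

namespace ZVar

theorem lt_iff {v w : ZVar p n} : v < w ↔ v.level < w.level ∨ v.level = w.level ∧
    (v.row < w.row ∨ v.row = w.row ∧
      residue n ((v.col : ℤ) - ((v.level : ℤ) * (p : ℤ) + (v.row : ℤ)))
        < residue n ((w.col : ℤ) - ((w.level : ℤ) * (p : ℤ) + (w.row : ℤ)))) := by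
  have : v < w ↔ key v < key w := Iff.rfl
  rw [this, key, key, Prod.Lex.toLex_lt_toLex]
  simp only [Prod.Lex.toLex_lt_toLex, Fin.lt_def, Fin.ext_iff]

theorem le_of_lt {v w : ZVar p n} (h : v < w) :
    p * v.level + v.row ≤ p * w.level + w.row := by
  have h1 := v.row.isLt
  rcases lt_iff.1 h with h | ⟨h, h' | ⟨h', -⟩⟩
  · have := Nat.mul_le_mul_left p (Nat.succ_le_of_lt h)
    rw [Nat.mul_succ] at this
    omega
  · rw [h]
    exact Nat.add_le_add_left (Nat.le_of_lt h') _
  · rw [h, h']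

end ZVar

/-- Suppose another term is larger and let `v` be the last variable where it differs from `pbwExp`.
The factors after `v` agree, so the other term has in the row of `v` an earlier column at the same
level; by `IsPBWTuple.residue_le` that variable cannot precede `v`. -/
theorem isInitialExp_coeffMinor (hp : 1 ≤ p) (hpn : p < n) {I : Fin p → Fin n} {k : ℕ}
    (h : (I, k) ∈ pbwIndexSet p n) :
    (pbwOrder p n).IsInitialExp (coeffMinor I k) (pbwExp I k) := by
  classical
  have hpbw : IsPBWTuple fun j => residue n ((I j : ℤ) - (k : ℤ)) := h
  have hI : Function.Injective I := fun a b hab => hpbw.1 (by simp only [hab])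
  have hmem : pbwExp I k ∈ (coeffMinor I k).support := by
    rw [mem_support_iff, coeff_pbwExp_coeffMinor hI hp]
    simp
  refine ⟨hmem, fun e he hne => ?_⟩
  rcases (pbwOrder p n).total e (pbwExp I k) with hlt | heq | hlt
  · exact hlt
  · exact absurd heq hne
  exfalso
  obtain ⟨π, κ, hκ, rfl⟩ := exists_of_mem_support_coeffMinor he
  have hdeg : ∀ e ∈ (coeffMinor I k).support, e.degree = p := fun e he => by
    rw [degree_eq_sum_weight, coeffMinor_isWeightedHomogeneous I k (mem_support_iff.1 he)]
    simp
  rcases hlt with hlt | ⟨-, v, hv, hv'⟩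
  · rw [hdeg _ he, hdeg _ hmem] at hlt
    exact lt_irrefl _ hlt
  set ρ := rowEquiv p k with hρ
  rw [pbwExp_eq_transversalExp] at hv hv'
  simp only [transversalExp_apply] at hv hv'
  have hv1 : I (ρ.symm v.row) = v.col ∧ (k + ρ.symm v.row) / p = v.level := by
    by_contra hc
    rw [if_neg hc] at hv
    exact Nat.not_lt_zero _ hv
  rw [if_pos hv1, Nat.lt_one_iff] at hv
  have hv2 : ¬ (I (π v.row) = v.col ∧ κ v.row = v.level) := fun hc => by simp [hc] at hv
  have hiff : ∀ w, v < w → (I (ρ.symm w.row) = w.col ∧ (k + ρ.symm w.row) / p = w.level ↔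
      I (π w.row) = w.col ∧ κ w.row = w.level) := fun w hw => by
    have h1 := hv' w hw
    split_ifs at h1 with h2 h3 h3
    exacts [iff_of_true h2 h3, iff_of_false h2 h3]
  have hdm : ∀ i, p * ((k + ρ.symm i) / p) + i = k + ρ.symm i := fun i => by
    have h1 := Nat.div_add_mod (k + ρ.symm i) p
    rwa [← rowEquiv_val, ← hρ, Equiv.apply_symm_apply] at h1
  have hNv : p * v.level + v.row = k + ρ.symm v.row := by rw [← hv1.2, hdm]
  -- A factor of the other term on a higher level than that of `pbwExp` in the same row would lie
  -- beyond `v`, where the monomials agree.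
  have hle : ∀ i, κ i ≤ (k + ρ.symm i) / p := by
    intro i
    by_contra hc
    have h1 : ¬ v < ⟨i, I (π i), κ i⟩ := fun hlt =>
      hc ((hiff _ hlt).2 ⟨rfl, rfl⟩).2.ge
    have h3 : p * κ i + i ≤ p * v.level + v.row := by
      rcases (not_lt.1 h1).eq_or_lt with h4 | h4
      · rw [← h4]
      · exact ZVar.le_of_lt h4
    have h5 := Nat.mul_le_mul_left p (Nat.succ_le_of_lt (not_le.1 hc))
    rw [Nat.mul_succ] at h5
    have h6 := hdm i
    have h7 := (ρ.symm v.row).isLt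
    omega
  -- Both families of levels have sum `k`.
  have hκeq : ∀ i, κ i = (k + ρ.symm i) / p := by
    have h1 := (Finset.sum_eq_sum_iff_of_le fun i _ => hle i).1 (by
      rw [hκ, Equiv.sum_comp ρ.symm fun t : Fin p => (k + t) / p, sum_add_div k hp])
    exact fun i => h1 i (Finset.mem_univ i)
  have hlater : ∀ t, ρ.symm v.row < t → π (ρ t) = t := by
    intro t ht
    have h1 : v < ⟨ρ t, I t, (k + t) / p⟩ := by
      by_contra hc
      have h2 : p * ((k + t) / p) + (ρ t : ℕ) ≤ p * v.level + v.row := by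
        rcases (not_lt.1 hc).eq_or_lt with h4 | h4
        · rw [← h4]
        · exact ZVar.le_of_lt h4
      have h3 := hdm (ρ t)
      rw [Equiv.symm_apply_apply] at h3
      have h4 : (ρ.symm v.row : ℕ) < t := ht
      omega
    exact hI ((hiff _ h1).1 (by simp)).1
  have hcol : I (π v.row) ≠ v.col := fun hc => hv2 ⟨hc, by rw [hκeq, hv1.2]⟩
  -- The later columns are already used in other rows, and the column of `v` itself is excluded.
  have hlt : π v.row < ρ.symm v.row := by
    refine lt_of_le_of_ne (not_lt.1 fun hc => ?_) fun hc => hcol (by rw [hc, hv1.1])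
    have h1 := π.injective (hlater _ hc)
    have h2 : π v.row = ρ.symm v.row := by rw [← h1, Equiv.symm_apply_apply, h1]
    exact hcol (by rw [h2, hv1.1])
  have hres := hpbw.residue_le hpn hlt
  have hnot : ¬ v < ⟨v.row, I (π v.row), v.level⟩ := fun hlt =>
    hcol (((hiff _ hlt).2 ⟨rfl, by rw [hκeq]; exact hv1.2⟩).1.symm.trans hv1.1)
  have hne' : v ≠ ⟨v.row, I (π v.row), v.level⟩ := fun h1 => hcol (congrArg ZVar.col h1).symm
  have hgt : (⟨v.row, I (π v.row), v.level⟩ : ZVar p n) < v :=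
    lt_of_le_of_ne (not_lt.1 hnot) hne'.symm
  have hN : (v.level : ℤ) * p + v.row = k + (ρ.symm v.row : ℕ) := by
    rw [mul_comm]
    exact_mod_cast hNv
  rcases ZVar.lt_iff.1 hgt with h1 | ⟨-, h1 | ⟨-, h1⟩⟩
  · exact lt_irrefl _ h1
  · exact lt_irrefl _ h1
  · simp only [hN, ← sub_sub] at h1
    rw [← hv1.1] at h1
    exact absurd h1 (not_lt.2 hres)

end Plucker

/-! ### The minors with PBW indices generate the algebra -/

section Plucker

variable {p n : ℕ}

/-- Take a permutation with the most entries in their own place and, among these, with the least `∑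
t * β (π t)`. A misplaced entry below `p` could be swapped into place. A pair of increasing entries
that are at least `p`, hence never in their own place, could be swapped to lower the sum. -/
theorem exists_perm_isPBWTuple {β : Fin p → ℕ} (hβ : Function.Injective β) :
    ∃ π : Equiv.Perm (Fin p), IsPBWTuple (β ∘ π) := by
  classical
  let fix : Equiv.Perm (Fin p) → Finset (Fin p) := fun π => Finset.univ.filter fun t => β (π t) = t
  let F : Equiv.Perm (Fin p) → ℕ ×ₗ ℕᵒᵈ := fun π =>
    toLex ((fix π).card, OrderDual.toDual (∑ t : Fin p, (t : ℕ) * β (π t)))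
  obtain ⟨π, hπ⟩ := Finite.exists_max F
  have hfix : ∀ π t, t ∈ fix π ↔ β (π t) = t := fun π t => by simp [fix]
  have hinj : Function.Injective (β ∘ π) := hβ.comp π.injective
  have hmem : ∀ j l t, t ≠ j → t ≠ l → t ∈ fix π → t ∈ fix (π * Equiv.swap j l) := by
    intro j l t hj hl ht
    rw [hfix] at ht ⊢
    rwa [Equiv.Perm.mul_apply, Equiv.swap_apply_of_ne_of_ne hj hl]
  refine ⟨π, hinj, fun j hj => ?_, fun j l hlt hl => ?_⟩
  · by_contra hne
    set l : Fin p := ⟨β (π j), hj⟩ with hl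
    have hlj : l ≠ j := fun h => hne (congrArg Fin.val h)
    have hlt : (fix π).card < (fix (π * Equiv.swap j l)).card := by
      refine Finset.card_lt_card (Finset.ssubset_iff_of_subset (fun t ht => ?_) |>.2 ⟨l, ?_, ?_⟩)
      · refine hmem j l t ?_ ?_ ht
        · rintro rfl
          exact hne ((hfix π t).1 ht)
        · rintro rfl
          exact hlj (hinj ((hfix π l).1 ht))
      · rw [hfix, Equiv.Perm.mul_apply, Equiv.swap_apply_right]
      · rw [hfix]
        exact fun h => hlj (hinj h)
    refine not_lt.2 (hπ (π * Equiv.swap j l)) ?_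
    rw [Prod.Lex.toLex_lt_toLex]
    exact Or.inl hlt
  · by_contra hc
    have hlj : l < j := lt_of_le_of_ne (not_lt.1 hc) fun h => by
      rw [h] at hlt
      exact lt_irrefl _ hlt
    have hle : (fix π).card ≤ (fix (π * Equiv.swap j l)).card := by
      refine Finset.card_le_card fun t ht => ?_
      have h1 := (hfix π t).1 ht
      have h2 := t.isLt
      refine hmem j l t ?_ ?_ ht
      · rintro rfl
        simp only [Function.comp_apply] at hlt hl
        omega
      · rintro rfl
        simp only [Function.comp_apply] at hl
        omega
    have hsum : ∑ t : Fin p, (t : ℕ) * β ((π * Equiv.swap j l) t)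
        < ∑ t : Fin p, (t : ℕ) * β (π t) := by
      have hl' : l ∈ (Finset.univ : Finset (Fin p)).erase j := by simp [hlj.ne]
      rw [← Finset.add_sum_erase _ _ (Finset.mem_univ j), ← Finset.add_sum_erase _ _ hl',
        ← Finset.add_sum_erase _ (fun t : Fin p => (t : ℕ) * β (π t)) (Finset.mem_univ j),
        ← Finset.add_sum_erase _ (fun t : Fin p => (t : ℕ) * β (π t)) hl', ← add_assoc, ← add_assoc]
      refine add_lt_add_of_lt_of_le ?_ (Finset.sum_le_sum fun t ht => ?_)
      · simp only [Equiv.Perm.mul_apply, Equiv.swap_apply_left, Equiv.swap_apply_right]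
        have h1 : (l : ℕ) < j := hlj
        have h2 : β (π l) < β (π j) := hlt
        nlinarith
      · simp only [Finset.mem_erase] at ht
        rw [Equiv.Perm.mul_apply, Equiv.swap_apply_of_ne_of_ne ht.2.1 ht.1]
    refine not_lt.2 (hπ (π * Equiv.swap j l)) ?_
    rw [Prod.Lex.toLex_lt_toLex]
    rcases hle.lt_or_eq with h | h
    · exact Or.inl h
    · exact Or.inr ⟨h, OrderDual.toDual_lt_toDual.2 hsum⟩

theorem coeffMinor_comp_perm (I : Fin p → Fin n) (k : ℕ) (π : Equiv.Perm (Fin p)) :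
    coeffMinor (I ∘ π) k = ((Equiv.Perm.sign π : ℤ) : ℂ) • coeffMinor I k := by
  have h1 : ((seriesMatrix p n).submatrix id (I ∘ π))
      = ((seriesMatrix p n).submatrix id I).submatrix id π := rfl
  have h2 : (((Equiv.Perm.sign π : ℤ) : PowerSeries (MvPolynomial (ZVar p n) ℂ)))
      = PowerSeries.C (C ((Equiv.Perm.sign π : ℤ) : ℂ)) := by simp
  rw [coeffMinor, h1, Matrix.det_permute', h2, PowerSeries.coeff_C_mul, smul_eq_C_mul]
  rfl

theorem coeffMinor_eq_zero {I : Fin p → Fin n} (hI : ¬ Function.Injective I) (k : ℕ) :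
    coeffMinor I k = 0 := by
  simp only [Function.Injective, not_forall] at hI
  obtain ⟨a, b, hab, hne⟩ := hI
  rw [coeffMinor, Matrix.det_zero_of_column_eq hne fun i => by simp [hab], map_zero]

/-- A minor with distinct columns is, up to sign, one with a PBW index at the same `k`; the others
vanish. -/
theorem adjoin_pbw_eq_semiInfinitePlucker (hpn : p < n) :
    Algebra.adjoin ℂ ((fun Ik : (Fin p → Fin n) × ℕ => coeffMinor Ik.1 Ik.2) '' pbwIndexSet p n)
      = semiInfinitePlucker p n := by
  refine le_antisymm (Algebra.adjoin_mono ?_) (Algebra.adjoin_le ?_)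
  · rintro _ ⟨⟨I, k⟩, -, rfl⟩
    exact ⟨I, k, rfl⟩
  rintro _ ⟨I, k, rfl⟩
  by_cases hI : Function.Injective I
  · have hβ : Function.Injective fun j => residue n ((I j : ℤ) - (k : ℤ)) := by
      intro a b hab
      have h1 := residue_modEq (n := n) (by omega) ((I a : ℤ) - k)
      have h2 := residue_modEq (n := n) (by omega) ((I b : ℤ) - k)
      simp only at hab
      rw [hab] at h1
      have h3 : (I a : ℤ) ≡ I b [ZMOD n] := by
        simpa using (h1.symm.trans h2).add_right (k : ℤ)
      have h4 := (Int.natCast_modEq_iff.1 h3)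
      rw [Nat.ModEq, Nat.mod_eq_of_lt (I a).isLt, Nat.mod_eq_of_lt (I b).isLt] at h4
      exact hI (Fin.ext h4)
    obtain ⟨π, hπ⟩ := exists_perm_isPBWTuple hβ
    have h1 : coeffMinor I k = ((Equiv.Perm.sign π : ℤ) : ℂ) • coeffMinor (I ∘ π) k := by
      rw [coeffMinor_comp_perm, smul_smul]
      rcases Int.units_eq_one_or (Equiv.Perm.sign π) with h | h <;> simp [h]
    rw [h1]
    exact Subalgebra.smul_mem _ (Algebra.subset_adjoin (Set.mem_image_of_mem
      (fun Ik : (Fin p → Fin n) × ℕ => coeffMinor Ik.1 Ik.2)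
      (show (I ∘ π, k) ∈ pbwIndexSet p n from hπ))) _
  · rw [coeffMinor_eq_zero hI]
    exact Subalgebra.zero_mem _

end Plucker

/-! ### From diagonal products to PBW products -/

section Encode

variable {p n : ℕ}

/-- The position that follows `x i` in the cyclic sequence `x 0, …, x (p - 1), x 0 + n, …`. -/
def nextPos (n : ℕ) (x : Fin p → ℕ) (i : Fin p) : ℕ :=
  if h : (i : ℕ) + 1 < p then x ⟨i + 1, h⟩ else x ⟨0, i.pos⟩ + n

/-- The distance from the starting column of the variable that encodes the entry `x i`. -/
def gapDist (n : ℕ) (x : Fin p → ℕ) (i : Fin p) : ℕ :=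
  if nextPos n x i = x i + 1 then 0 else (x i + 1) % n

/-- The exponent vector of the product of one variable from each row that encodes the positions
`x 0 < ⋯ < x (p - 1) < x 0 + n`. -/
noncomputable def encode [NeZero n] (x : Fin p → ℕ) : ZVar p n →₀ ℕ :=
  transversalExp (fun r => Fin.ofNat n (x r.rev / n * p + r + gapDist n x r.rev))
    (fun r => x r.rev / n)

theorem add_sub_le_of_lt_nextPos {x : Fin p → ℕ} (hx : ∀ i, x i < nextPos n x i) {i j : Fin p}
    (hij : i ≤ j) : x i + (j - i) ≤ x j := by
  obtain ⟨j, hj⟩ := j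
  induction j with
  | zero =>
    have : i = ⟨0, hj⟩ := Fin.ext (Nat.le_zero.1 hij)
    simp [this]
  | succ j ih =>
    have hij' : (i : ℕ) ≤ j + 1 := hij
    rcases hij'.eq_or_lt with h | h
    · have : i = ⟨j + 1, hj⟩ := Fin.ext h
      simp [this]
    · have h1 := ih (by omega) (by rw [Fin.le_def]; exact Nat.lt_succ_iff.1 h)
      have h2 := hx ⟨j, by omega⟩
      rw [nextPos, dif_pos hj] at h2
      simp only at h1 h2 ⊢
      omega

/-- Follow the cyclic sequence from `x j` through `x (p - 1)` and `x 0 + n` to `x i + n`; each step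
gains at least one. -/
theorem lt_add_of_lt_nextPos {x : Fin p → ℕ} (hx : ∀ i, x i < nextPos n x i) (i j : Fin p) :
    x j + (p - 1 - j) + 1 + i ≤ x i + n := by
  have hi := i.isLt
  have hj := j.isLt
  have h1 := hx ⟨p - 1, by omega⟩
  rw [nextPos, dif_neg (by simp only; omega)] at h1
  have h2 := add_sub_le_of_lt_nextPos hx (i := ⟨0, by omega⟩) (j := i) (Nat.zero_le _)
  have h3 := add_sub_le_of_lt_nextPos hx (i := j) (j := ⟨p - 1, by omega⟩)
    (by rw [Fin.le_def]; simp only; omega)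
  simp only at h1 h2 h3
  omega

/-- The levels of the positions take two consecutive values. -/
theorem exists_level_threshold [NeZero n] {x : Fin p → ℕ} (hp : 0 < p)
    (hx : ∀ i, x i < nextPos n x i) : ∃ l q, 1 ≤ q ∧ q ≤ p ∧ ∀ i : Fin p,
      ((i : ℕ) < q ∧ n * l ≤ x i ∧ x i < n * l + n) ∨
      (q ≤ i ∧ n * l + n ≤ x i ∧ x i < n * l + n + n) := by
  classical
  have hn : 0 < n := Nat.pos_of_neZero n
  set l := x ⟨0, hp⟩ / n with hl
  have h0 : n * l ≤ x ⟨0, hp⟩ ∧ x ⟨0, hp⟩ < n * l + n := by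
    have h1 := Nat.div_add_mod (x ⟨0, hp⟩) n
    have h2 := Nat.mod_lt (x ⟨0, hp⟩) hn
    rw [← hl] at h1
    omega
  have hlow : ∀ i : Fin p, n * l ≤ x i := fun i => by
    have := add_sub_le_of_lt_nextPos hx (i := ⟨0, hp⟩) (j := i) (Nat.zero_le _)
    omega
  have hup : ∀ i : Fin p, x i < n * l + n + n := fun i => by
    have := lt_add_of_lt_nextPos hx ⟨0, hp⟩ i
    omega
  -- The threshold is the first index on the upper level, or `p` if there is none.
  have hex : ∃ q, q = p ∨ ∃ h : q < p, n * l + n ≤ x ⟨q, h⟩ := ⟨p, Or.inl rfl⟩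
  refine ⟨l, Nat.find hex, ?_, Nat.find_min' hex (Or.inl rfl), fun i => ?_⟩
  · rw [Nat.one_le_iff_ne_zero]
    intro h
    have h1 := Nat.find_spec hex
    rw [h] at h1
    rcases h1 with h1 | ⟨_, h1⟩
    · omega
    · omega
  · by_cases hi : (i : ℕ) < Nat.find hex
    · have h1 := Nat.find_min hex hi
      push Not at h1
      exact Or.inl ⟨hi, hlow i, h1.2 i.isLt⟩
    · refine Or.inr ⟨not_lt.1 hi, ?_, hup i⟩
      rcases Nat.find_spec hex with h1 | ⟨h1, h2⟩
      · have := i.isLt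
        omega
      · have := add_sub_le_of_lt_nextPos hx (i := ⟨_, h1⟩) (j := i) (not_lt.1 hi)
        omega

/-- With rows reversed, the positions on the lower level and then those on the upper level fill `p`
consecutive values `k, …, k + p - 1` of `p * level + row`. The shifted tuple has entries `t + a t`:
distance `0` gives an entry in its own place, and a nonzero distance requires a gap, which puts the
entry between `p` and `n` and makes such entries decrease. -/
theorem exists_encode_eq_pbwExp [NeZero n] (hp : 0 < p) (hpn : p < n) {x : Fin p → ℕ}
    (hx : ∀ i, x i < nextPos n x i) :
    ∃ Ik ∈ pbwIndexSet p n, encode x = pbwExp Ik.1 Ik.2 := by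
  have hn : 0 < n := Nat.pos_of_neZero n
  obtain ⟨l, q₀, hq1, hqp, hlev⟩ := exists_level_threshold hp hx
  have hdiv : ∀ i : Fin p, ((i : ℕ) < q₀ → x i / n = l ∧ x i % n = x i - n * l) ∧
      (q₀ ≤ i → x i / n = l + 1 ∧ x i % n = x i - (n * l + n)) := by
    intro i
    have key : ∀ m, n * m ≤ x i → x i < n * m + n → x i / n = m ∧ x i % n = x i - n * m := by
      intro m h1 h2
      have h3 : x i / n = m := Nat.div_eq_of_lt_le (by rwa [mul_comm])
        (by rwa [mul_comm, mul_add, mul_one])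
      refine ⟨h3, ?_⟩
      have h4 := Nat.div_add_mod (x i) n
      rw [h3] at h4
      omega
    refine ⟨fun h => ?_, fun h => ?_⟩ <;> rcases hlev i with h' | h'
    · exact key l h'.2.1 h'.2.2
    · omega
    · omega
    · simpa [Nat.mul_succ] using key (l + 1) h'.2.1 h'.2.2
  -- The last position on the lower level has index `q₀ - 1`, so it is put in row `p - q₀` on level
  -- `l`, the first of the values.
  set k := p * l + (p - q₀) with hk
  -- The index of the position encoded at `k + t`: the lower level backwards, then the upper level
  -- backwards.
  let q : Fin p → Fin p := fun t =>
    if h : (t : ℕ) < q₀ then ⟨q₀ - 1 - t, by omega⟩ else ⟨p + q₀ - 1 - t, by omega⟩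
  have hq : ∀ t : Fin p, ((t : ℕ) < q₀ ∧ (q t : ℕ) = q₀ - 1 - t) ∨
      (q₀ ≤ (t : ℕ) ∧ (q t : ℕ) = p + q₀ - 1 - t) := fun t => by
    simp only [q]
    split_ifs with h
    · exact Or.inl ⟨h, rfl⟩
    · exact Or.inr ⟨not_lt.1 h, rfl⟩
  set a : Fin p → ℕ := fun t => gapDist n x (q t) with ha
  -- the description of the nonzero distances
  have hadef : ∀ t, a t = 0 ∨ (nextPos n x (q t) ≠ x (q t) + 1 ∧ 0 < a t ∧ a t < n ∧
      (((t : ℕ) < q₀ ∧ a t + n * l = x (q t) + 1) ∨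
        (q₀ ≤ (t : ℕ) ∧ a t + (n * l + n) = x (q t) + 1))) := by
    intro t
    by_cases h0 : a t = 0
    · exact Or.inl h0
    right
    have hne : nextPos n x (q t) ≠ x (q t) + 1 := fun h => h0 (by simp only [ha, gapDist, if_pos h])
    have hval : a t = (x (q t) + 1) % n := by simp only [ha, gapDist, if_neg hne]
    have hlt : a t < n := hval ▸ Nat.mod_lt _ hn
    have hmod : a t = x (q t) % n + 1 := by
      rw [hval] at h0 ⊢
      rw [Nat.add_mod] at h0 ⊢
      have h1 := Nat.mod_lt (x (q t)) hn
      rw [Nat.mod_eq_of_lt (show 1 < n by omega)] at h0 ⊢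
      rcases (Nat.succ_le_of_lt h1).eq_or_lt with h2 | h2
      · rw [← Nat.succ_eq_add_one, h2, Nat.mod_self] at h0
        exact absurd rfl h0
      · exact Nat.mod_eq_of_lt h2
    refine ⟨hne, Nat.pos_of_ne_zero h0, hlt, ?_⟩
    have h3 := t.isLt
    rcases hq t with h | h
    · have h2 := ((hdiv (q t)).1 (by omega)).2
      have h4 := hlev (q t)
      exact Or.inl ⟨h.1, by omega⟩
    · have h2 := ((hdiv (q t)).2 (by omega)).2
      have h4 := hlev (q t)
      exact Or.inr ⟨h.1, by omega⟩
  have hstep : ∀ i j : Fin p, i ≤ j → x i + (j - i) ≤ x j := fun i j => add_sub_le_of_lt_nextPos hx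
  have hwrap := lt_add_of_lt_nextPos hx
  -- consequences of a gap after `x i`
  have hgap : ∀ i : Fin p, nextPos n x i ≠ x i + 1 → (∀ j, i < j → x i + (j - i) + 1 ≤ x j) ∧
      ∀ j : Fin p, x i + (p - 1 - i) + 2 + j ≤ x j + n := by
    intro i hi
    have h1 := hx i
    have h0 := i.isLt
    by_cases hip : (i : ℕ) + 1 < p
    · rw [nextPos, dif_pos hip] at hi h1
      refine ⟨fun j hj => ?_, fun j => ?_⟩
      · have h2 := hstep ⟨i + 1, hip⟩ j (by rw [Fin.le_def]; exact hj)
        have h3 : (i : ℕ) < j := hj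
        simp only at h2
        omega
      · have h2 := hwrap j ⟨i + 1, hip⟩
        simp only at h2
        omega
    · rw [nextPos, dif_neg hip] at hi h1
      refine ⟨fun j hj => ?_, fun j => ?_⟩
      · have h3 : (i : ℕ) < j := hj
        omega
      · have h2 := hstep ⟨0, hp⟩ j (Nat.zero_le _)
        simp only at h2
        omega
  -- Lower bound: the positions before `x (q t)` on its level, including those shifted by `n`, need
  -- room. Upper bound: so do those after it, and the gap makes this inequality strict.
  have hrange : ∀ t, a t = 0 ∨ (p ≤ t + a t ∧ t + a t < n) := by
    intro t
    rcases hadef t with h | ⟨hne, hpos, hltn, hcase⟩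
    · exact Or.inl h
    right
    have ht := t.isLt
    have hqt := (q t).isLt
    obtain ⟨g1, g2⟩ := hgap _ hne
    have u1 := hlev ⟨q₀ - 1, by omega⟩
    simp only at u1
    have u2 := g2 ⟨q₀ - 1, by omega⟩
    have u3 : ∀ h : q₀ < p, n * l + n ≤ x ⟨q₀, h⟩ := fun h => by
      have := hlev ⟨q₀, h⟩
      simp only at this
      omega
    have u4 := hlev (q t)
    have u5 := hlev ⟨0, hp⟩
    simp only at u2 u5
    rcases hq t with ⟨h1, h2⟩ | ⟨h1, h2⟩
    · have v1 : x (q t) + 1 + (q₀ - 1 - q t) < n * l + n := by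
        by_cases h3 : (q t : ℕ) = q₀ - 1
        · omega
        · have := g1 ⟨q₀ - 1, by omega⟩ (by rw [Fin.lt_def]; simp only; omega)
          simp only at this
          omega
      by_cases h4 : q₀ < p
      · have v2 := hwrap (q t) ⟨q₀, h4⟩
        have v3 := u3 h4
        simp only at v2
        omega
      · have v2 := hstep ⟨0, hp⟩ (q t) (Nat.zero_le _)
        simp only at v2
        omega
    · have h4 : q₀ < p := by omega
      have v2 := hstep ⟨q₀, h4⟩ (q t) (by rw [Fin.le_def]; simp only; omega)
      have v3 := u3 h4
      simp only at v2
      omega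
  -- From `x (q t')` to `x (q t)` there are `t' - t` cyclic steps, and the first crosses a gap, so
  -- the position grows by more than `t' - t`.
  have hdec : ∀ t t', a t ≠ 0 → a t' ≠ 0 → t < t' → t' + a t' < t + a t := by
    intro t t' h h' hlt
    have hlt' : (t : ℕ) < t' := hlt
    have ht := t'.isLt
    obtain ⟨-, -, -, hc⟩ := (hadef t).resolve_left h
    obtain ⟨hne, -, -, hc'⟩ := (hadef t').resolve_left h'
    obtain ⟨g1, g2⟩ := hgap _ hne
    have w1 := hq t
    have w2 := hq t'
    by_cases h1 : q t' < q t
    · have h2 := g1 _ h1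
      have h3 : (q t' : ℕ) < q t := h1
      omega
    · have h2 := g2 (q t)
      have h3 : (q t : ℕ) ≤ q t' := not_lt.1 h1
      omega
  let I : Fin p → Fin n := fun t => Fin.ofNat n (k + t + a t)
  have hres : ∀ t, residue n ((I t : ℤ) - k) = t + a t := by
    intro t
    have h1 : (t : ℕ) + a t < n := by
      have := t.isLt
      rcases hrange t with h | h <;> omega
    rw [← residue_natCast h1]
    refine residue_eq_of_modEq ?_
    have h2 : ((I t : ℕ) : ℤ) ≡ ((k + t + a t : ℕ) : ℤ) [ZMOD n] :=
      Int.natCast_modEq_iff.2 (Nat.mod_modEq _ _)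
    have h3 := h2.sub_right (k : ℤ)
    have h4 : ((k + t + a t : ℕ) : ℤ) - k = ((t + a t : ℕ) : ℤ) := by push_cast; ring
    rwa [h4] at h3
  refine ⟨(I, k), ?_, ?_⟩
  · change IsPBWTuple fun j => residue n ((I j : ℤ) - (k : ℤ))
    simp only [hres]
    refine ⟨fun t t' htt => ?_, fun t ht => ?_, fun t t' h1 h2 => ?_⟩
    · simp only at htt
      have h3 := t.isLt
      have h4 := t'.isLt
      by_cases h : a t = 0
      · rcases hrange t' with h' | h'
        · exact Fin.ext (by omega)
        · omega
      · by_cases h' : a t' = 0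
        · have := (hrange t).resolve_left h
          omega
        · rcases lt_trichotomy t t' with h5 | h5 | h5
          · have := hdec t t' h h' h5
            omega
          · exact h5
          · have := hdec t' t h' h h5
            omega
    · rcases hrange t with h | h
      · simp [h]
      · simp only at ht
        omega
    · simp only at h1 h2
      have h3 := t.isLt
      have h4 := t'.isLt
      rcases lt_trichotomy t t' with h5 | h5 | h5
      · exact h5
      · rw [h5] at h1
        exact absurd h1 (lt_irrefl _)
      · have := hdec t' t (by omega) (by omega) h5
        omega
  · rw [encode, pbwExp_eq_transversalExp]
    have hrow : ∀ r : Fin p, q ((rowEquiv p k).symm r) = r.rev ∧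
        (k + (rowEquiv p k).symm r) / p = x r.rev / n ∧
        x r.rev / n * p + r = k + (rowEquiv p k).symm r := by
      intro r
      set t := (rowEquiv p k).symm r with ht
      have h1 : (k + t) % p = r := by
        rw [← rowEquiv_val, ht, Equiv.apply_symm_apply]
      have h2 := t.isLt
      have h3 := r.isLt
      have h4 : q t = r.rev ∧ (k + t) / p = x (q t) / n := by
        rcases hq t with ⟨h5, h6⟩ | ⟨h5, h6⟩
        · have h7 : k + t = p * l + (p - q₀ + t) := by omega
          rw [h7, Nat.mul_add_mod, Nat.mod_eq_of_lt (by omega)] at h1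
          refine ⟨Fin.ext (by rw [Fin.val_rev]; omega), ?_⟩
          rw [((hdiv (q t)).1 (by omega)).1, h7, Nat.mul_add_div hp,
            Nat.div_eq_of_lt (by omega), add_zero]
        · have h7 : k + t = p * (l + 1) + (t - q₀) := by rw [Nat.mul_succ]; omega
          rw [h7, Nat.mul_add_mod, Nat.mod_eq_of_lt (by omega)] at h1
          refine ⟨Fin.ext (by rw [Fin.val_rev]; omega), ?_⟩
          rw [((hdiv (q t)).2 (by omega)).1, h7, Nat.mul_add_div hp,
            Nat.div_eq_of_lt (by omega), add_zero]
      refine ⟨h4.1, by rw [h4.2, h4.1], ?_⟩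
      rw [← h4.1, ← h4.2, ← h1, mul_comm]
      exact Nat.div_add_mod _ _
    congr 1
    · funext r
      obtain ⟨h1, -, h3⟩ := hrow r
      simp only [I, ha]
      rw [h3, h1]
    · funext r
      exact (hrow r).2.1.symm

end Encode

/-! ### The injection of diagonal standard monomials into the PBW monoid -/

section Encode

variable {p n : ℕ} [NeZero n]

/-- The position of the `s`-th variable of `m` in row `i`. -/
noncomputable def cell (m : ZVar p n →₀ ℕ) (s : ℕ) (i : Fin p) : ℕ :=
  sInf {j | s < rowCount m i (j + 1)}

/-- The product of the encodings of the diagonal products that make up `m`. -/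
noncomputable def pbwImage (d : ℕ) (m : ZVar p n →₀ ℕ) : ZVar p n →₀ ℕ :=
  ∑ s ∈ Finset.range d, encode (cell m s)

variable {m : ZVar p n →₀ ℕ} {d : ℕ}

theorem exists_rowCount_eq (hd : (Finsupp.weight gradeWeight m).1 = fun _ => d) :
    ∃ L, ∀ i j, L ≤ j → rowCount m i j = d := by
  obtain ⟨L, hL⟩ := exists_rowCount_eq_weight m
  exact ⟨L, fun i j h => by rw [hL i j h, hd]⟩

theorem rowCount_le (hd : (Finsupp.weight gradeWeight m).1 = fun _ => d) (i : Fin p) (j : ℕ) :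
    rowCount m i j ≤ d := by
  obtain ⟨L, hL⟩ := exists_rowCount_eq hd
  rw [← hL i (max j L) (le_max_right _ _)]
  exact rowCount_mono m i (le_max_left _ _)

/-- `cell` inverts `rowCount`; for `s < d` the set in its definition is nonempty, so the infimum is
attained. -/
theorem cell_lt_iff (hd : (Finsupp.weight gradeWeight m).1 = fun _ => d) {s : ℕ} (hs : s < d)
    (i : Fin p) (j : ℕ) : cell m s i < j ↔ s < rowCount m i j := by
  obtain ⟨L, hL⟩ := exists_rowCount_eq hd
  have hne : {j | s < rowCount m i (j + 1)}.Nonempty := ⟨L, by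
    rw [Set.mem_ofPred_eq, hL i _ (by omega)]; exact hs⟩
  constructor
  · intro h
    have hmem : s < rowCount m i (cell m s i + 1) := Nat.sInf_mem hne
    exact lt_of_lt_of_le hmem (rowCount_mono m i h)
  · intro h
    rcases j with _ | j
    · exact absurd h (Nat.not_lt_zero _)
    · exact Nat.lt_succ_iff.2 (Nat.sInf_le h)

theorem nextPos_cell_lt_iff (hd : (Finsupp.weight gradeWeight m).1 = fun _ => d) {s : ℕ}
    (hs : s < d) (i : Fin p) (j : ℕ) :
    nextPos n (cell m s) i < j + 1 ↔ s < nextCount m i j := by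
  rw [nextPos, nextCount]
  split_ifs with h
  · exact cell_lt_iff hd hs _ _
  · rw [← cell_lt_iff hd hs]
    omega

/-- This is the standardness inequality between counts, read for the `s`-th variables of consecutive
rows. -/
theorem cell_lt_nextPos (hd : (Finsupp.weight gradeWeight m).1 = fun _ => d)
    (hm : IsDiagStandard m) {s : ℕ} (hs : s < d) (i : Fin p) :
    cell m s i < nextPos n (cell m s) i := by
  have h1 := (nextPos_cell_lt_iff hd hs i _).1 (Nat.lt_succ_self (nextPos n (cell m s) i))
  exact (cell_lt_iff hd hs _ _).2 (h1.trans_le (hm _ _))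

theorem sum_range_ite_eq_sub {a b d : ℕ} (hb : b ≤ d) (P : ℕ → Prop) [DecidablePred P]
    (hP : ∀ s, s < d → (P s ↔ a ≤ s ∧ s < b)) :
    ∑ s ∈ Finset.range d, (if P s then 1 else 0) = b - a := by
  rw [← Finset.card_filter, ← Nat.card_Ico]
  congr 1
  ext s
  simp only [Finset.mem_filter, Finset.mem_range, Finset.mem_Ico]
  constructor
  · rintro ⟨h1, h2⟩
    exact (hP s h1).1 h2
  · intro h
    exact ⟨by omega, (hP s (by omega)).2 h⟩

/-- Sort each row by position and collect the `s`-th variables of all rows. -/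
theorem eq_sum_transversalExp_cell (hd : (Finsupp.weight gradeWeight m).1 = fun _ => d) :
    m = ∑ s ∈ Finset.range d,
      transversalExp (fun i => Fin.ofNat n (cell m s i)) (fun i => cell m s i / n) := by
  classical
  refine eq_of_rowCount_eq fun i j => ?_
  rw [rowCount]
  conv_rhs => rw [rowCount]
  simp only [Finsupp.finsetSum_apply]
  rw [Finset.sum_comm]
  have h1 : ∀ s, ∑ l ∈ Finset.range j, transversalExp (fun i => Fin.ofNat n (cell m s i))
      (fun i => cell m s i / n) (posVar i l) = if cell m s i < j then 1 else 0 := by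
    intro s
    have h2 : ∀ l, transversalExp (fun i => Fin.ofNat n (cell m s i))
        (fun i => cell m s i / n) (posVar i l) = if cell m s i = l then 1 else 0 := by
      intro l
      rw [transversalExp_apply]
      congr 1
      refine propext ⟨fun h => posVar_injective (n := n) i ?_, fun h => ?_⟩
      · exact ZVar.ext rfl h.1 h.2
      · subst h
        exact ⟨rfl, rfl⟩
    simp only [h2, Finset.sum_ite_eq, Finset.mem_range]
  simp only [h1]
  rw [sum_range_ite_eq_sub (a := 0) (rowCount_le hd i j) _ fun s hs => by
    rw [cell_lt_iff hd hs]; simp]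
  rfl

/-- Encoding keeps the levels and only reverses the rows, each of which has one variable per factor.
-/
theorem weight_pbwImage (hd : (Finsupp.weight gradeWeight m).1 = fun _ => d) :
    Finsupp.weight gradeWeight (pbwImage d m) = Finsupp.weight gradeWeight m := by
  conv_rhs => rw [eq_sum_transversalExp_cell hd]
  rw [pbwImage, map_sum, map_sum]
  refine Finset.sum_congr rfl fun s _ => ?_
  rw [encode, weight_transversalExp, weight_transversalExp,
    ← Equiv.sum_comp Fin.revPerm fun i => cell m s i / n]
  rfl

/-- A nonzero distance `a` on level `l` records the position `n * l + a - 1` followed by a gap. The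
`s` for which this happens form an interval. -/
theorem pbwImage_apply (hd : (Finsupp.weight gradeWeight m).1 = fun _ => d)
    (hm : IsDiagStandard m) (i : Fin p) (l a : ℕ) (ha0 : 0 < a) (han : a < n) :
    pbwImage d m ⟨i.rev, Fin.ofNat n (l * p + i.rev + a), l⟩
      = rowCount m i (n * l + a)
        - max (rowCount m i (n * l + a - 1)) (nextCount m i (n * l + a)) := by
  classical
  have hn : 0 < n := Nat.pos_of_neZero n
  rw [pbwImage, Finsupp.finsetSum_apply]
  simp only [encode, transversalExp_apply, Fin.rev_rev]
  refine sum_range_ite_eq_sub (rowCount_le hd i _) _ fun s hs => ?_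
  have h1 : (Fin.ofNat n (cell m s i / n * p + i.rev + gapDist n (cell m s) i)
        = Fin.ofNat n (l * p + i.rev + a) ∧ cell m s i / n = l) ↔
      cell m s i + 1 = n * l + a ∧ nextPos n (cell m s) i ≠ n * l + a := by
    have hgap : gapDist n (cell m s) i < n := by
      rw [gapDist]
      split_ifs
      · exact hn
      · exact Nat.mod_lt _ hn
    constructor
    · rintro ⟨h2, h3⟩
      rw [h3] at h2
      have h4 : l * p + i.rev + gapDist n (cell m s) i ≡ l * p + i.rev + a [MOD n] :=
        Fin.mk.inj_iff.1 h2
      have h5 := Nat.ModEq.add_left_cancel' _ h4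
      rw [Nat.ModEq, Nat.mod_eq_of_lt hgap, Nat.mod_eq_of_lt han, gapDist] at h5
      split_ifs at h5 with h6
      · omega
      · have h7 := Nat.div_add_mod (cell m s i) n
        have h8 := Nat.mod_lt (cell m s i) hn
        rw [h3] at h7
        have h9 : cell m s i + 1 = n * l + a := by
          rw [← h7, add_assoc, Nat.mul_add_mod] at h5
          rcases (Nat.succ_le_of_lt h8).eq_or_lt with h | h
          · rw [← Nat.succ_eq_add_one, h, Nat.mod_self] at h5
            omega
          · rw [Nat.mod_eq_of_lt h] at h5
            omega
        exact ⟨h9, by rw [← h9]; exact h6⟩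
    · rintro ⟨h2, h3⟩
      have h4 : cell m s i / n = l :=
        Nat.div_eq_of_lt_le (by rw [mul_comm]; omega) (by rw [Nat.succ_mul, mul_comm]; omega)
      refine ⟨?_, h4⟩
      rw [gapDist, if_neg (by rw [h2]; exact h3), h2, Nat.mul_add_mod, Nat.mod_eq_of_lt han, h4]
  rw [h1, max_le_iff]
  have h2 := cell_lt_iff hd hs i (n * l + a)
  have h3 := cell_lt_iff hd hs i (n * l + a - 1)
  have h4 := nextPos_cell_lt_iff hd hs i (n * l + a)
  have h5 := cell_lt_nextPos hd hm hs i
  omega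

/-- Distance `0` does not determine the position; summing over columns leaves the level, which is
always recorded. -/
theorem sum_pbwImage_apply (hd : (Finsupp.weight gradeWeight m).1 = fun _ => d)
    (i : Fin p) (l : ℕ) : ∑ c, pbwImage d m ⟨i.rev, c, l⟩
      = rowCount m i (n * l + n) - rowCount m i (n * l) := by
  classical
  have hn : 0 < n := Nat.pos_of_neZero n
  simp only [pbwImage, Finsupp.finsetSum_apply]
  rw [Finset.sum_comm]
  have h1 : ∀ s, ∑ c, encode (cell m s) (⟨i.rev, c, l⟩ : ZVar p n)
      = if cell m s i / n = l then 1 else 0 := by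
    intro s
    simp only [encode, transversalExp_apply, Fin.rev_rev]
    by_cases h : cell m s i / n = l
    · simp [h]
    · simp [h]
  simp only [h1]
  refine sum_range_ite_eq_sub (rowCount_le hd i _) _ fun s hs => ?_
  have h2 := cell_lt_iff hd hs i (n * l)
  have h3 := cell_lt_iff hd hs i (n * l + n)
  have h4 : cell m s i / n = l ↔ n * l ≤ cell m s i ∧ cell m s i < n * l + n := by
    rw [Nat.div_eq_iff hn, mul_comm]
    omega
  rw [h4]
  omega

/-- Levels give the counts at multiples of `n`. The others follow recursively from `pbwImage_apply`:
by monotonicity and standardness the subtracted maximum is at most `rowCount m i j`, so truncated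
subtraction loses nothing. -/
theorem pbwImage_injOn (hpn : p < n) {m' : ZVar p n →₀ ℕ}
    (hd : (Finsupp.weight gradeWeight m).1 = fun _ => d) (hm : IsDiagStandard m)
    (hd' : (Finsupp.weight gradeWeight m').1 = fun _ => d) (hm' : IsDiagStandard m')
    (h : pbwImage d m = pbwImage d m') : m = m' := by
  have hn : 0 < n := Nat.pos_of_neZero n
  have hlevel : ∀ (i : Fin p) l, rowCount m i (n * l) = rowCount m' i (n * l) := by
    intro i l
    induction l with
    | zero => rfl
    | succ l ih =>
      have h1 := sum_pbwImage_apply hd i l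
      rw [h, sum_pbwImage_apply hd' i l] at h1
      have h2 := rowCount_mono m i (Nat.le_add_right (n * l) n)
      have h3 := rowCount_mono m' i (Nat.le_add_right (n * l) n)
      rw [Nat.mul_succ]
      omega
  -- The measure drops by `p` from `j` to `j - 1`, and by `1` from `(i, j)` to `(i + 1, j + 1)`.
  -- From the last row to `(0, j + 1 - n)` it drops by `p * (n - 1) - (p * p - 1)`, which is
  -- positive since `p < n`.
  have key : ∀ N, ∀ (i : Fin p) j, p * j + (p + 1) * (p - 1 - i) < N →
      rowCount m i j = rowCount m' i j := by
    intro N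
    induction N with
    | zero => exact fun i j h => absurd h (Nat.not_lt_zero _)
    | succ N ih =>
      intro i j hN
      have hj := Nat.div_add_mod j n
      rcases Nat.eq_zero_or_pos (j % n) with h0 | h0
      · rw [h0, add_zero] at hj
        rw [← hj]
        exact hlevel i _
      · have hi := i.isLt
        have hp : 0 < p := by omega
        have h1 := pbwImage_apply hd hm i (j / n) (j % n) h0 (Nat.mod_lt _ hn)
        rw [h, pbwImage_apply hd' hm' i (j / n) (j % n) h0 (Nat.mod_lt _ hn), hj] at h1
        have hj0 : 0 < j := by
          rcases Nat.eq_zero_or_pos j with h | h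
          · rw [h, Nat.zero_mod] at h0
            omega
          · exact h
        have h2 : rowCount m i (j - 1) = rowCount m' i (j - 1) := by
          refine ih i (j - 1) ?_
          have : p * j = p * (j - 1) + p := by
            conv_lhs => rw [show j = j - 1 + 1 by omega, Nat.mul_succ]
          omega
        have h3 : nextCount m i j = nextCount m' i j := by
          rw [nextCount, nextCount]
          split_ifs with hip
          · refine ih _ _ ?_
            simp only
            obtain ⟨u, hu⟩ : ∃ u, p - 1 - (i : ℕ) = u + 1 := ⟨p - 1 - (i : ℕ) - 1, by omega⟩
            have hu' : p - 1 - ((i : ℕ) + 1) = u := by omega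
            rw [hu] at hN
            rw [hu']
            nlinarith
          · by_cases hjn : j + 1 ≤ n
            · rw [Nat.sub_eq_zero_of_le hjn]
              rfl
            · refine ih _ _ ?_
              simp only
              obtain ⟨u, hu⟩ : ∃ u, j + 1 = u + n := ⟨j + 1 - n, by omega⟩
              have hu' : j + 1 - n = u := by omega
              rw [hu']
              obtain ⟨w, hw⟩ : ∃ w, j = u + p + w := ⟨j - u - p, by omega⟩
              have hsq : ∀ q, 0 < q → (q + 1) * (q - 1) + 1 = q * q := by
                rintro (_ | q) hq
                · omega
                · rw [Nat.add_sub_cancel]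
                  ring
              have h8 := hsq p hp
              rw [hw, mul_add, mul_add] at hN
              rw [Nat.sub_zero]
              omega
        have h4 := rowCount_mono m i (Nat.sub_le j 1)
        have h5 := rowCount_mono m' i (Nat.sub_le j 1)
        have h6 := hm i j
        have h7 := hm' i j
        omega
  exact eq_of_rowCount_eq fun i j => key _ i j (Nat.lt_succ_self _)

end Encode

/-! ### The initial subalgebra -/

theorem MonOrder.IsInitialExp.mul {σ : Type*} {o : MonOrder σ} {f g : MvPolynomial σ ℂ}
    {a b : σ →₀ ℕ} (hf : o.IsInitialExp f a) (hg : o.IsInitialExp g b) :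
    o.IsInitialExp (f * g) (a + b) := by
  have hf0 : f ≠ 0 := fun h => by simpa [h] using hf.1
  have hg0 : g ≠ 0 := fun h => by simpa [h] using hg.1
  obtain ⟨c, hc⟩ := o.exists_isInitialExp (mul_ne_zero hf0 hg0)
  have h1 := o.initialTerm_mul f g
  rw [hf.initialTerm_eq, hg.initialTerm_eq, hc.initialTerm_eq, monomial_mul] at h1
  rcases (monomial_eq_monomial_iff _ _ _ _).1 h1 with h | h
  · rwa [h.1]
  · exact absurd h.2 (mem_support_iff.1 hc.1)

section Plucker

variable {p n : ℕ}

/-- The second component of the weight bounds the levels that occur, the first bounds the exponents.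
-/
theorem finite_setOf_weight_eq (ω : (Fin p → ℕ) × ℕ) :
    {u : ZVar p n →₀ ℕ | Finsupp.weight gradeWeight u = ω}.Finite := by
  classical
  have hfin : {v : ZVar p n | v.level ≤ ω.2}.Finite :=
    (Set.finite_range fun x : Fin p × Fin n × Fin (ω.2 + 1) =>
      (⟨x.1, x.2.1, x.2.2⟩ : ZVar p n)).subset fun v hv =>
        ⟨(v.row, v.col, ⟨v.level, Nat.lt_succ_of_le hv⟩), rfl⟩
  let M : ZVar p n →₀ ℕ := Finsupp.onFinset hfin.toFinset
    (fun v => if v.level ≤ ω.2 then ω.1 v.row else 0) fun v hv => by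
      rw [Set.Finite.mem_toFinset]
      by_contra h
      exact hv (if_neg h)
  refine (Set.finite_Icc 0 M).subset fun u hu => ⟨zero_le, fun v => ?_⟩
  have h1 : Finsupp.weight gradeWeight (u.erase v) + u v • gradeWeight v = ω := by
    rw [← Finsupp.weight_single, ← map_add, Finsupp.erase_add_single]
    exact hu
  have h2 : u v ≤ ω.1 v.row := by
    rw [← h1]
    simp [gradeWeight]
  have h3 : u v * v.level ≤ ω.2 := by
    rw [← h1]
    simp [gradeWeight]
  change u v ≤ if v.level ≤ ω.2 then ω.1 v.row else 0
  split_ifs with h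
  · exact h2
  · by_contra h0
    exact h (le_trans (Nat.le_mul_of_pos_left _ (by omega)) h3)

variable (p n) in
/-- The monoid generated by the exponent vectors of the initial terms of the minors. -/
noncomputable def pbwMonoid : AddSubmonoid (ZVar p n →₀ ℕ) :=
  AddSubmonoid.closure {e | ∃ Ik ∈ pbwIndexSet p n, e = pbwExp Ik.1 Ik.2}

theorem exists_isInitialExp_of_mem_pbwMonoid (hp : 1 ≤ p) (hpn : p < n) {g : ZVar p n →₀ ℕ}
    (hg : g ∈ pbwMonoid p n) : ∃ f ∈ semiInfinitePlucker p n, (pbwOrder p n).IsInitialExp f g ∧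
      IsWeightedHomogeneous gradeWeight f (Finsupp.weight gradeWeight g) := by
  induction hg using AddSubmonoid.closure_induction with
  | mem g hg =>
    obtain ⟨⟨I, k⟩, hIk, rfl⟩ := hg
    have h1 := isInitialExp_coeffMinor hp hpn hIk
    have h2 := coeffMinor_isWeightedHomogeneous I k
    refine ⟨coeffMinor I k, Algebra.subset_adjoin ⟨I, k, rfl⟩, h1, ?_⟩
    rwa [← h2 (mem_support_iff.1 h1.1)] at h2
  | zero =>
    refine ⟨1, one_mem _, ⟨by simp, fun e he hne => ?_⟩, ?_⟩
    · rw [← C_1] at he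
      exact absurd (Finset.mem_singleton.1 (support_monomial_subset he)) hne
    · rw [map_zero]
      exact isWeightedHomogeneous_one _ _
  | add a b _ _ ha hb =>
    obtain ⟨f, hf, hf1, hf2⟩ := ha
    obtain ⟨g, hg, hg1, hg2⟩ := hb
    exact ⟨f * g, mul_mem hf hg, hf1.mul hg1, by rw [map_add]; exact hf2.mul hg2⟩

theorem pbwImage_mem_pbwMonoid [NeZero n] (hp : 1 ≤ p) (hpn : p < n) {m : ZVar p n →₀ ℕ} {d : ℕ}
    (hd : (Finsupp.weight gradeWeight m).1 = fun _ => d) (hm : IsDiagStandard m) :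
    pbwImage d m ∈ pbwMonoid p n :=
  sum_mem fun _ hs => AddSubmonoid.subset_closure <|
    exists_encode_eq_pbwExp hp hpn (cell_lt_nextPos hd hm (Finset.mem_range.1 hs))

/-- Elements with distinct initial monomials are linearly independent. -/
theorem MonOrder.sum_smul_ne_zero {σ : Type*} (o : MonOrder σ) {B : Finset (σ →₀ ℕ)}
    {F : (σ →₀ ℕ) → MvPolynomial σ ℂ} (hF : ∀ g ∈ B, o.IsInitialExp (F g) g)
    {c : B → ℂ} (hc : c ≠ 0) : ∑ g : B, c g • F g ≠ 0 := by
  classical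
  -- `Q` keeps only the leading monomials, to pick the largest `g` with nonzero coefficient; no
  -- other summand contributes to that monomial.
  set Q : MvPolynomial σ ℂ := ∑ g : B, monomial (g : σ →₀ ℕ) (c g) with hQ
  have hcoeff : ∀ g : B, Q.coeff g = c g := fun g => by
    rw [hQ, coeff_sum, Finset.sum_eq_single g]
    · simp
    · intro g' _ hne
      rw [coeff_monomial, if_neg fun h => hne (Subtype.ext h)]
    · simp
  have hQ0 : Q ≠ 0 := by
    rintro h
    refine hc (funext fun g => ?_)
    rw [← hcoeff, h]
    rfl
  obtain ⟨g₀, hg₀, hmax⟩ := o.exists_isInitialExp hQ0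
  have hB : g₀ ∈ B := by
    by_contra h
    refine mem_support_iff.1 hg₀ ?_
    rw [hQ, coeff_sum]
    refine Finset.sum_eq_zero fun g _ => ?_
    rw [coeff_monomial, if_neg]
    rintro rfl
    exact h g.2
  intro h0
  have h1 := congrArg (coeff g₀) h0
  rw [coeff_sum, Finset.sum_eq_single (⟨g₀, hB⟩ : B)] at h1
  · rw [coeff_smul, coeff_zero, smul_eq_mul, ← hcoeff ⟨g₀, hB⟩] at h1
    exact mul_ne_zero (mem_support_iff.1 hg₀) (mem_support_iff.1 (hF g₀ hB).1) h1
  · intro g _ hne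
    rw [coeff_smul, smul_eq_mul]
    by_contra h2
    have hne' : (g : σ →₀ ℕ) ≠ g₀ := fun h => hne (Subtype.ext h)
    have h3 := (hF g g.2).2 g₀ (mem_support_iff.2 (right_ne_zero_of_mul h2)) hne'.symm
    have h4 := hmax g (mem_support_iff.2 (by rw [hcoeff]; exact left_ne_zero_of_mul h2)) hne'
    exact o.irrefl _ (o.trans _ _ _ h3 h4)
  · simp

/-- Otherwise the graded piece of `m` contains elements with `G.card + 1` distinct initial
monomials, while there are only `T.card ≤ G.card` diagonal standard monomials for their combinations
to contain. -/
theorem mem_pbwMonoid_of_isInitialExp (hp : 1 ≤ p) (hpn : p < n) {f : MvPolynomial (ZVar p n) ℂ}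
    (hf : f ∈ semiInfinitePlucker p n) {m : ZVar p n →₀ ℕ}
    (hm : (pbwOrder p n).IsInitialExp f m) : m ∈ pbwMonoid p n := by
  classical
  have : NeZero n := ⟨by omega⟩
  by_contra hnot
  set ω := Finsupp.weight gradeWeight m with hω
  obtain ⟨d, hd⟩ := exists_weight_eq_of_mem_semiInfinitePlucker hf hm.1
  rw [← hω] at hd
  set W := (finite_setOf_weight_eq (n := n) ω).toFinset with hW
  have hmemW : ∀ u, u ∈ W ↔ Finsupp.weight gradeWeight u = ω := fun u => by
    rw [hW, Set.Finite.mem_toFinset]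
    rfl
  set T := W.filter IsDiagStandard with hT
  set G := W.filter (· ∈ pbwMonoid p n) with hG
  have hcard : T.card ≤ G.card := by
    refine Finset.card_le_card_of_injOn (pbwImage d) (fun t ht => ?_) fun t ht t' ht' h => ?_
    · obtain ⟨h1, h2⟩ := Finset.mem_filter.1 ht
      rw [hmemW] at h1
      have h3 : (Finsupp.weight gradeWeight t).1 = fun _ => d := by rw [h1, hd]
      refine Finset.mem_filter.2 ⟨?_, pbwImage_mem_pbwMonoid hp hpn h3 h2⟩
      rw [hmemW, weight_pbwImage h3, h1]
    · obtain ⟨h1, h2⟩ := Finset.mem_filter.1 ht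
      obtain ⟨h1', h2'⟩ := Finset.mem_filter.1 ht'
      rw [hmemW] at h1 h1'
      exact pbwImage_injOn hpn (by rw [h1, hd]) h2 (by rw [h1', hd]) h2' h
  have hmG : m ∉ G := fun h => hnot (Finset.mem_filter.1 h).2
  set B := insert m G with hB
  have hBcard : B.card = G.card + 1 := Finset.card_insert_of_notMem hmG
  have hex : ∀ g ∈ B, ∃ F ∈ semiInfinitePlucker p n, (pbwOrder p n).IsInitialExp F g ∧
      IsWeightedHomogeneous gradeWeight F ω := by
    intro g hg
    rcases Finset.mem_insert.1 hg with rfl | hg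
    · refine ⟨weightedHomogeneousComponent gradeWeight ω f,
        weightedHomogeneousComponent_mem_semiInfinitePlucker hf ω, ⟨?_, fun e he hne => ?_⟩,
        weightedHomogeneousComponent_isWeightedHomogeneous _ _⟩
      · rw [mem_support_iff, coeff_weightedHomogeneousComponent, if_pos rfl]
        exact mem_support_iff.1 hm.1
      · refine hm.2 e ?_ hne
        rw [mem_support_iff, coeff_weightedHomogeneousComponent] at he
        rw [mem_support_iff]
        split_ifs at he with h
        · exact he
        · exact absurd rfl he
    · obtain ⟨h1, h2⟩ := Finset.mem_filter.1 hg
      obtain ⟨F, hF1, hF2, hF3⟩ := exists_isInitialExp_of_mem_pbwMonoid hp hpn h2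
      rw [(hmemW g).1 h1] at hF3
      exact ⟨F, hF1, hF2, hF3⟩
  choose! F hF1 hF2 hF3 using hex
  -- `Φ` reads off the diagonal standard coefficients of a combination. A nonzero kernel vector
  -- gives a nonzero element of the algebra without such a monomial.
  let Φ : (B → ℂ) →ₗ[ℂ] (T → ℂ) :=
    LinearMap.pi fun t => ∑ g : B,
      (LinearMap.proj g : (B → ℂ) →ₗ[ℂ] ℂ).smulRight
        ((F g).coeff t)
  have hker : LinearMap.ker Φ ≠ ⊥ := by
    refine LinearMap.ker_ne_bot_of_finrank_lt ?_
    rw [Module.finrank_fintype_fun_eq_card, Module.finrank_fintype_fun_eq_card, Fintype.card_coe,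
      Fintype.card_coe, hBcard]
    omega
  obtain ⟨c, hc, hc0⟩ := (Submodule.ne_bot_iff _).1 hker
  have hP0 := (pbwOrder p n).sum_smul_ne_zero hF2 hc0
  have hPmem : ∑ g : B, c g • F g ∈ semiInfinitePlucker p n :=
    sum_mem fun g _ => Subalgebra.smul_mem _ (hF1 g g.2) _
  have hPhom : IsWeightedHomogeneous gradeWeight
      (∑ g : B, c g • F g) ω :=
    IsWeightedHomogeneous.sum _ _ _ fun g _ =>
      (weightedHomogeneousSubmodule ℂ gradeWeight ω).smul_mem _ (hF3 g g.2)
  obtain ⟨t, ht, ht'⟩ := exists_isDiagStandard_mem_support hPmem hP0 hPhom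
  have htT : t ∈ T := Finset.mem_filter.2 ⟨(hmemW t).2 (hPhom (mem_support_iff.1 ht)), ht'⟩
  refine mem_support_iff.1 ht ?_
  have h1 := congrFun (LinearMap.mem_ker.1 hc) ⟨t, htT⟩
  rw [coeff_sum]
  simpa [Φ, coeff_smul] using h1

theorem monomial_mem_adjoin_initialTerm (hp : 1 ≤ p) (hpn : p < n) {m : ZVar p n →₀ ℕ}
    (hm : m ∈ pbwMonoid p n) (a : ℂ) : monomial m a ∈ Algebra.adjoin ℂ
      ((pbwOrder p n).initialTerm ''
        ((fun Ik : (Fin p → Fin n) × ℕ => coeffMinor Ik.1 Ik.2) '' pbwIndexSet p n)) := by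
  induction hm using AddSubmonoid.closure_induction generalizing a with
  | mem e he =>
    obtain ⟨⟨I, k⟩, hIk, rfl⟩ := he
    have h1 := isInitialExp_coeffMinor hp hpn hIk
    have h2 : monomial (pbwExp I k) a = (a / (coeffMinor I k).coeff (pbwExp I k)) •
        (pbwOrder p n).initialTerm (coeffMinor I k) := by
      rw [h1.initialTerm_eq, smul_monomial, smul_eq_mul,
        div_mul_cancel₀ _ (mem_support_iff.1 h1.1)]
    simp only [h2]
    exact Subalgebra.smul_mem _ (Algebra.subset_adjoin
      (Set.mem_image_of_mem _ (Set.mem_image_of_mem (fun Ik : (Fin p → Fin n) × ℕ =>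
        coeffMinor Ik.1 Ik.2) hIk))) _
  | zero => exact Subalgebra.algebraMap_mem _ a
  | add e e' _ _ he he' =>
    have : (monomial (e + e') a : MvPolynomial (ZVar p n) ℂ) = monomial e a * monomial e' 1 := by
      rw [monomial_mul, mul_one]
    rw [this]
    exact mul_mem (he a) (he' 1)

end Plucker

theorem theorem4 (p n : ℕ) (hp : 1 ≤ p) (hpn : p < n) :
    (pbwOrder p n).IsSagbiBasis
      ((fun Ik : (Fin p → Fin n) × ℕ => coeffMinor Ik.1 Ik.2) '' pbwIndexSet p n)
      (semiInfinitePlucker p n) := by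
  refine ⟨adjoin_pbw_eq_semiInfinitePlucker hpn, le_antisymm (Algebra.adjoin_le ?_) ?_⟩
  · rintro _ ⟨_, ⟨⟨I, k⟩, -, rfl⟩, rfl⟩
    exact Submodule.subset_span ⟨coeffMinor I k, Algebra.subset_adjoin ⟨I, k, rfl⟩, rfl⟩
  · intro g hg
    have hg' : g ∈ Submodule.span ℂ ((pbwOrder p n).initialTerm ''
        (semiInfinitePlucker p n : Set (MvPolynomial (ZVar p n) ℂ))) := hg
    rw [← Subalgebra.mem_toSubmodule]
    refine Submodule.span_le.2 ?_ hg'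
    rintro _ ⟨f, hf, rfl⟩
    by_cases hf0 : f = 0
    · rw [hf0, MonOrder.initialTerm_zero]
      exact zero_mem _
    · obtain ⟨m, hm⟩ := (pbwOrder p n).exists_isInitialExp hf0
      rw [hm.initialTerm_eq]
      exact monomial_mem_adjoin_initialTerm hp hpn (mem_pbwMonoid_of_isInitialExp hp hpn hf hm) _
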